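/- Let $\mathsf h=\bigotimes_{j\ge1}(L_2(\mathbb R),\varphi)$ be the infinite tensor product of copies of $L_2(\mathbb R)$ stabilized at the vacuum $\varphi(x)=\pi^{-1/4}e^{-x^2/2}$, i.e. the completion of the span of the sequences $(v_j)$ with $v_j=\varphi$ for all but finitely many $j$, with inner product $\prod_j\langle v_j,w_j\rangle$ (inner products are antilinear in the first variable). For $z\in\ell_2(\mathbb N)$ let $\varepsilon_z=\lim_n\varepsilon_{z_1}\otimes\cdots\otimes\varepsilon_{z_n}\otimes\varphi\otimes\varphi\otimes\cdots$, where $\varepsilon_{c}(x)=e^{\sqrt2\,cx-c^2/2}\varphi(x)$ for $c\in\mathbb C$. Let $W_z$ be the unique unitary operator on $\mathsf h$ with $W_z\varepsilon_u=e^{-\frac12\|z\|^2-\langle z,u\rangle}\varepsilon_{z+u}$ for all $u\in\ell_2(\mathbb N)$, and let $p(z)$ be the self-adjoint operator with $W_{tz}=e^{-itp(z)}$, $t\in\mathbb R$. Put $(z,u)=\operatorname{Re}\langle z,u\rangle$. Let $\rho=\rho(w,S)$ be a Gaussian state: $\rho$ is a positive trace-class operator on $\mathsf h$ with trace one, $w\in\ell_2(\mathbb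 N)$, $S$ is a bounded real-linear operator on $\ell_2(\mathbb N)$ that is self-adjoint for $(\cdot,\cdot)$, and $$\frac1{\sqrt\pi}\operatorname{tr}(\rho W_z)=\frac1{\sqrt\pi}e^{-i(w,z)-\frac12(z,Sz)}\qquad\text{for all }z\in\ell_2(\mathbb N).$$ For a self-adjoint operator $A$ and $\epsilon>0$ let $(iA)_\epsilon=iA(I+\epsilon iA)^{-1}$ be the Yosida approximation of $iA$, and let the $n$-th moment of $A$ in $\rho$ be $$\langle A^n\rangle_\rho=(-i)^n\lim_{\epsilon\to0^+}\operatorname{tr}\big(\rho\,((iA)_\epsilon)^n\big)=(-i)^n\frac{d^n}{dt^n}\operatorname{tr}\big(\rho e^{itA}\big)\Big|_{t=0}.$$ Then for every $z\in\ell_2(\mathbb N)$ and every integer $n\ge0$ the function $t\mapsto\operatorname{tr}(\rho e^{it(p(z)-(w,z))})$ is $n$ times continuously differentiable near $0$, both expressions for the $n$-th moment of $p(z)-(w,z)$ exist, and both are equal to $$\big\langle (p(z)-(w,z))^n\big\rangle_\rho=\begin{cases}0,& n\text{ odd},\\ (z,Sz)^{n/2}\,(n-1)!!,& n\text{ even},\end{cases}$$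 where $(-1)!!=1$ and $0^0=1$. -/

import Mathlib

open scoped ComplexConjugate

namespace BosonGaussian

noncomputable section

open MeasureTheory Filter Topology

/-! ### One mode: the space `L²(ℝ)` and its exponential vectors -/

/-- The one-mode space `L²(ℝ)`. -/
abbrev L2R : Type := Lp ℂ 2 (volume : Measure ℝ)

/-- The vacuum function `π^{-1/4} e^{-x²/2}`. -/
def vacuumFun (x : ℝ) : ℂ := ((Real.pi ^ (-(1 / 4) : ℝ) * Real.exp (-x ^ 2 / 2) : ℝ) : ℂ)

/-- The function `e^{√2 z x - z²/2} π^{-1/4} e^{-x²/2}`. -/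
def expFun (z : ℂ) (x : ℝ) : ℂ :=
  Complex.exp ((Real.sqrt 2 : ℂ) * z * x - z ^ 2 / 2) * vacuumFun x

lemma pi_rpow_sq : ((Real.pi ^ (-(1 / 4) : ℝ) : ℝ) : ℂ) * ((Real.pi ^ (-(1 / 4) : ℝ) : ℝ) : ℂ)
    * ((Real.pi : ℂ) ^ (1 / 2 : ℂ)) = 1 := by
  have h : ((Real.pi : ℂ) ^ (1 / 2 : ℂ)) = ((Real.pi ^ (1 / 2 : ℝ) : ℝ) : ℂ) := by
    rw [Complex.ofReal_cpow Real.pi_pos.le]; norm_num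
  rw [h]
  norm_cast
  rw [← Real.rpow_add Real.pi_pos, ← Real.rpow_add Real.pi_pos]
  norm_num

lemma sqrt_two_sq : ((Real.sqrt 2 : ℝ) : ℂ) ^ 2 = 2 := by
  norm_cast; rw [Real.sq_sqrt (by norm_num)]

lemma expFun_mul (z w : ℂ) (x : ℝ) : conj (expFun z x) * expFun w x =
    (((Real.pi ^ (-(1 / 4) : ℝ) : ℝ) : ℂ) * ((Real.pi ^ (-(1 / 4) : ℝ) : ℝ) : ℂ)) *
      Complex.exp ((-1 : ℂ) * (x : ℂ) ^ 2 + ((Real.sqrt 2 : ℂ) * (conj z + w)) * x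
        + (-((conj z) ^ 2 + w ^ 2) / 2)) := by
  have h : ∀ a b : ℂ, Complex.exp ((-1 : ℂ) * (x : ℂ) ^ 2 + ((Real.sqrt 2 : ℂ) * (a + b)) * x
        + (-(a ^ 2 + b ^ 2) / 2)) =
      Complex.exp ((Real.sqrt 2 : ℂ) * a * x - a ^ 2 / 2) *
      Complex.exp ((Real.sqrt 2 : ℂ) * b * x - b ^ 2 / 2) *
      (Complex.exp (-x ^ 2 / 2) * Complex.exp (-x ^ 2 / 2)) := by
    intro a b
    rw [← Complex.exp_add, ← Complex.exp_add, ← Complex.exp_add]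
    congr 1; ring
  rw [h]
  simp only [expFun, vacuumFun, map_mul, ← Complex.exp_conj, Complex.conj_ofReal, map_sub,
    map_div₀, map_pow, Complex.ofReal_mul, Complex.ofReal_exp, Complex.ofReal_div,
    Complex.ofReal_neg, Complex.ofReal_pow, Complex.ofReal_ofNat, Complex.conj_ofNat, map_neg]
  ring

lemma integrable_expFun_mul (z w : ℂ) : Integrable fun x => conj (expFun z x) * expFun w x := by
  simp_rw [expFun_mul]
  exact (integrable_cexp_quadratic' (by norm_num) _ _).const_mul _

lemma integral_expFun_mul (z w : ℂ) :
    ∫ x, conj (expFun z x) * expFun w x = Complex.exp (conj z * w) := by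
  simp_rw [expFun_mul]
  rw [integral_const_mul, integral_cexp_quadratic (by norm_num), neg_neg, div_one, ← mul_assoc,
    pi_rpow_sq, one_mul]
  congr 1
  rw [mul_pow, sqrt_two_sq]; ring

lemma continuous_expFun (z : ℂ) : Continuous (expFun z) := by
  unfold expFun vacuumFun; fun_prop

lemma memLp_expFun (z : ℂ) : MemLp (expFun z) 2 (volume : Measure ℝ) := by
  rw [memLp_two_iff_integrable_sq_norm (continuous_expFun z).aestronglyMeasurable]
  have := (integrable_expFun_mul z z).norm
  refine this.congr (Eventually.of_forall fun x => ?_)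
  simp [sq]

/-- The exponential vector `ε_z` of `L²(ℝ)`. -/
def expVec (z : ℂ) : L2R := (memLp_expFun z).toLp _

lemma expFun_zero : expFun 0 = vacuumFun := by
  ext x; simp [expFun]

lemma memLp_vacuumFun : MemLp vacuumFun 2 (volume : Measure ℝ) := expFun_zero ▸ memLp_expFun 0

/-- The vacuum vector of `L²(ℝ)`. -/
def vacuum : L2R := memLp_vacuumFun.toLp _

lemma expVec_zero : expVec 0 = vacuum := by
  simp only [expVec, vacuum, expFun_zero]

lemma inner_expVec (z w : ℂ) : inner ℂ (expVec z) (expVec w) = Complex.exp (conj z * w) := by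
  rw [L2.inner_def, ← integral_expFun_mul]
  refine integral_congr_ae ?_
  filter_upwards [(memLp_expFun z).coeFn_toLp, (memLp_expFun w).coeFn_toLp] with x h1 h2
  simp only [expVec, h1, h2, RCLike.inner_apply]
  ring

lemma inner_vacuum : inner ℂ vacuum vacuum = 1 := by
  rw [← expVec_zero, inner_expVec]; simp

/-- The exponential vectors are total in `L²(ℝ)`. -/
lemma eq_zero_of_inner_expVec (f : L2R) (hf : ∀ z, inner ℂ (expVec z) f = 0) : f = 0 := by
  have hint : ∀ z, Integrable fun x => conj (expFun z x) * f x := by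
    intro z
    exact (memLp_expFun z).star.integrable_mul (Lp.memLp f)
  have h0 : ∀ z, ∫ x, conj (expFun z x) * f x = 0 := by
    intro z
    rw [← hf z, L2.inner_def]
    refine integral_congr_ae ?_
    filter_upwards [(memLp_expFun z).coeFn_toLp] with x h1
    simp only [expVec, h1, RCLike.inner_apply]
    ring
  set g : ℝ → ℂ := fun x => conj (expFun 0 x) * f x with hg
  have hFg : ∀ t : ℝ, FourierTransform.fourier g t = 0 := by
    intro t
    set z : ℂ := (Real.sqrt 2 * Real.pi * t : ℝ) * Complex.I with hz
    have h2 : ∀ x : ℝ, conj (expFun z x) * f x =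
        Complex.exp (-conj z ^ 2 / 2) * (Complex.exp ((-2 * Real.pi * t * x : ℝ) * Complex.I) * g x) := by
      intro x
      have : Complex.exp (conj ((Real.sqrt 2 : ℂ) * z * x - z ^ 2 / 2)) =
          Complex.exp (-conj z ^ 2 / 2) * Complex.exp ((-2 * Real.pi * t * x : ℝ) * Complex.I) := by
        rw [← Complex.exp_add]
        congr 1
        simp only [hz, map_sub, map_mul, Complex.conj_ofReal, Complex.conj_I, map_div₀, map_pow,
          Complex.conj_ofNat]
        push_cast
        have := sqrt_two_sq
        linear_combination (-Real.pi * t * x * Complex.I) * this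
      simp only [hg, expFun, map_mul, ← Complex.exp_conj, this]
      simp
      ring
    have h3 := h0 z
    simp_rw [h2] at h3
    rw [integral_const_mul] at h3
    have h4 := (mul_eq_zero.mp h3).resolve_left (Complex.exp_ne_zero _)
    rw [Real.fourier_eq', ← h4]
    congr 1; ext x
    simp only [smul_eq_mul]
    congr 3
    simp
    ring
  have hgae : ∀ᵐ x, g x = 0 := by
    refine ae_eq_zero_of_integral_contDiff_smul_eq_zero (hint 0).locallyIntegrable ?_
    intro h hh hc
    have hc' : HasCompactSupport (fun x => (h x : ℂ)) := hc.comp_left (g := fun y : ℝ => (y : ℂ)) (by simp)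
    let s : SchwartzMap ℝ ℂ := hc'.toSchwartzMap (Complex.ofRealCLM.contDiff.comp hh)
    have key := VectorFourier.integral_fourierIntegral_smul_eq_flip (μ := volume) (ν := volume)
      (L := innerₗ ℝ) (f := (FourierTransformInv.fourierInv s : SchwartzMap ℝ ℂ)) (g := g)
      Real.continuous_fourierChar continuous_inner
      (SchwartzMap.integrable _) (hint 0)
    have k1 : ∀ x, VectorFourier.fourierIntegral Real.fourierChar volume (innerₗ ℝ)
        ((FourierTransformInv.fourierInv s : SchwartzMap ℝ ℂ)) x = (h x : ℂ) := by
      intro x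
      have : (FourierTransform.fourier (FourierTransformInv.fourierInv s) : SchwartzMap ℝ ℂ) x
          = s x := by rw [FourierTransform.fourier_fourierInv_eq]
      rw [SchwartzMap.fourier_coe] at this
      exact this
    have k2 : ∀ x, VectorFourier.fourierIntegral Real.fourierChar volume (innerₗ ℝ).flip g x = 0 := by
      intro x
      rw [flip_innerₗ]
      exact hFg x
    simp_rw [k1, k2] at key
    simpa using key
  refine (Lp.eq_zero_iff_ae_eq_zero).mpr ?_
  filter_upwards [hgae] with x hx
  have hne : expFun 0 x ≠ 0 := by
    have : (0 : ℝ) < Real.pi ^ (-(1 / 4) : ℝ) := Real.rpow_pos_of_pos Real.pi_pos _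
    simp only [expFun, vacuumFun]
    refine mul_ne_zero (Complex.exp_ne_zero _) ?_
    norm_cast
    positivity
  exact (mul_eq_zero.mp hx).resolve_left (by simpa using hne)

/-! ### The stabilized infinite tensor product -/

/-- Sequences of vectors of `L²(ℝ)` all but finitely many of which are the vacuum. -/
structure StabSeq : Type where
  seq : ℕ → L2R
  finite : {j | seq j ≠ vacuum}.Finite

/-- The product `∏_j ⟨v_j, w_j⟩`, in which all but finitely many factors are `1`. -/
def stabKernel (v w : StabSeq) : ℂ := ∏ᶠ j, inner ℂ (v.seq j) (w.seq j)

lemma stabKernel_eq_prod (v w : StabSeq) (T : Finset ℕ) (hv : ∀ j ∉ T, v.seq j = vacuum)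
    (hw : ∀ j ∉ T, w.seq j = vacuum) : stabKernel v w = ∏ j ∈ T, inner ℂ (v.seq j) (w.seq j) := by
  refine finprod_eq_prod_of_mulSupport_subset _ fun j hj => ?_
  by_contra hT
  refine hj ?_
  simp only [Finset.mem_coe] at hT
  beta_reduce
  rw [hv j hT, hw j hT, inner_vacuum]

lemma conj_stabKernel (v w : StabSeq) : conj (stabKernel w v) = stabKernel v w := by
  classical
  have h1 : ∀ j ∉ v.finite.toFinset ∪ w.finite.toFinset, v.seq j = vacuum := by
    intro j hj; by_contra h; exact hj (by simp [h])
  have h2 : ∀ j ∉ v.finite.toFinset ∪ w.finite.toFinset, w.seq j = vacuum := by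
    intro j hj; by_contra h; exact hj (by simp [h])
  rw [stabKernel_eq_prod w v _ h2 h1, stabKernel_eq_prod v w _ h1 h2, map_prod]
  simp

open scoped ComplexOrder in
lemma posSemidef_inner {ι : Type*} {V : Type*} [NormedAddCommGroup V] [InnerProductSpace ℂ V]
    (v : ι → V) : (Matrix.of fun i j => inner ℂ (v i) (v j)).PosSemidef := by
  refine ⟨?_, fun x => ?_⟩
  · ext i j; simp
  · have : (x.sum fun i xi => x.sum fun j xj =>
        star xi * (Matrix.of fun i j => inner ℂ (v i) (v j)) i j * xj) =
        inner ℂ (x.sum fun i xi => xi • v i) (x.sum fun i xi => xi • v i) := by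
      simp only [Finsupp.sum, sum_inner, inner_sum, inner_smul_left, inner_smul_right,
        Matrix.of_apply, starRingEnd_apply]
      rw [Finset.sum_comm]
      refine Finset.sum_congr rfl fun i _ => ?_
      rw [Finset.mul_sum]
      refine Finset.sum_congr rfl fun j _ => ?_
      ring
    rw [this, inner_self_eq_norm_sq_to_K]
    norm_cast
    positivity

open scoped ComplexOrder in
lemma posSemidef_prod_inner (T : Finset ℕ) :
    (Matrix.of fun v w : StabSeq => ∏ j ∈ T, inner ℂ (v.seq j) (w.seq j)).PosSemidef := by
  classical
  induction T using Finset.induction_on with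
  | empty =>
    have h := posSemidef_inner (fun _ : StabSeq => (1 : ℂ))
    have h2 : (Matrix.of fun v w : StabSeq => ∏ j ∈ (∅ : Finset ℕ), inner ℂ (v.seq j) (w.seq j)) =
        Matrix.of fun _ _ : StabSeq => inner ℂ (1 : ℂ) (1 : ℂ) := by
      ext v w; simp
    rw [h2]; exact h
  | insert a T ha ih =>
    have h := (posSemidef_inner (fun v : StabSeq => v.seq a)).hadamard ih
    have h2 : (Matrix.of fun v w : StabSeq =>
        ∏ j ∈ insert a T, inner ℂ (v.seq j) (w.seq j)) =
        Matrix.hadamard (Matrix.of fun v w : StabSeq => inner ℂ (v.seq a) (w.seq a))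
          (Matrix.of fun v w : StabSeq => ∏ j ∈ T, inner ℂ (v.seq j) (w.seq j)) := by
      ext v w
      simp [Finset.prod_insert ha, Matrix.hadamard]
    rw [h2]; exact h

/-- The formal linear span of the stabilized sequences. -/
abbrev StabSpan : Type := StabSeq →₀ ℂ

/-- The sesquilinear extension of `⟨(v_j), (w_j)⟩ = ∏_j ⟨v_j, w_j⟩`. -/
def stabInner (f g : StabSpan) : ℂ :=
  f.sum fun v a => g.sum fun w b => conj a * b * stabKernel v w

lemma stabInner_self_nonneg (f : StabSeq →₀ ℂ) : 0 ≤ (stabInner f f).re := by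
  classical
  set T : Finset ℕ := f.support.biUnion fun v => v.finite.toFinset with hT
  have hT' : ∀ v ∈ f.support, ∀ j ∉ T, v.seq j = vacuum := by
    intro v hv j hj
    by_contra h
    exact hj (Finset.mem_biUnion.mpr ⟨v, hv, by simp [h]⟩)
  have h := (posSemidef_prod_inner T).2 f
  have h2 := (Complex.le_def.mp h).1
  refine h2.trans_eq (congrArg Complex.re ?_)
  simp only [stabInner, Finsupp.sum]
  refine Finset.sum_congr rfl fun v hv => Finset.sum_congr rfl fun w hw => ?_
  rw [stabKernel_eq_prod v w T (hT' v hv) (hT' w hw)]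
  simp only [Matrix.of_apply, starRingEnd_apply]
  ring

instance : PreInnerProductSpace.Core ℂ StabSpan where
  inner f g := stabInner f g
  conj_inner_symm f g := by
    simp only [stabInner]
    rw [Finsupp.sum_comm]
    simp only [map_finsuppSum, map_mul, Complex.conj_conj, conj_stabKernel]
    refine congrArg _ (funext fun v => funext fun a => congrArg _ (funext fun w => funext fun b => ?_))
    ring
  re_inner_nonneg f := stabInner_self_nonneg f
  add_left f g h := by
    simp only [stabInner]
    refine Finsupp.sum_add_index' (h := fun v a => Finsupp.sum h fun w b => conj a * b * stabKernel v w) ?_ ?_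
    · intro v; simp
    · intro v a b; simp [add_mul]
  smul_left f g r := by
    simp only [stabInner]
    refine (Finsupp.sum_smul_index (h := fun v a => Finsupp.sum g fun w b => conj a * b * stabKernel v w) ?_).trans ?_
    · intro v; simp
    · simp [Finsupp.mul_sum, ← mul_assoc]

instance : SeminormedAddCommGroup StabSpan :=
  InnerProductSpace.Core.toSeminormedAddCommGroup (𝕜 := ℂ)

instance : InnerProductSpace ℂ StabSpan := InnerProductSpace.ofCore _

/-- The stabilized infinite tensor product `𝗁 = ⨂_{j} (L²(ℝ), vacuum)`: the (Hausdorff)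
completion of the span of the stabilized sequences. -/
abbrev ModeSpace : Type := UniformSpace.Completion StabSpan

/-- The product vector `v_0 ⊗ v_1 ⊗ ⋯`. -/
def tensorVec (v : StabSeq) : ModeSpace := ((Finsupp.single v 1 : StabSpan) : ModeSpace)

lemma inner_tensorVec (v w : StabSeq) :
    inner ℂ (tensorVec v) (tensorVec w) = stabKernel v w := by
  rw [tensorVec, tensorVec, UniformSpace.Completion.inner_coe]
  change stabInner (Finsupp.single v 1) (Finsupp.single w 1) = _
  simp [stabInner]

lemma eq_zero_of_inner_tensorVec (f : ModeSpace) (hf : ∀ v, inner ℂ (tensorVec v) f = 0) :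
    f = 0 := by
  refine UniformSpace.Completion.denseRange_coe.eq_zero_of_inner_right ℂ fun g => ?_
  induction g using Finsupp.induction_linear with
  | zero =>
    have : ((0 : StabSpan) : ModeSpace) = 0 := UniformSpace.Completion.coe_zero
    rw [this, inner_zero_left]
  | add g h hg hh =>
    rw [UniformSpace.Completion.coe_add, inner_add_left, hg, hh, add_zero]
  | single v a =>
    have : ((Finsupp.single v a : StabSpan) : ModeSpace) = a • tensorVec v := by
      rw [tensorVec, ← UniformSpace.Completion.coe_smul]
      congr 1
      simp
    rw [this, inner_smul_left, hf, mul_zero]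

/-! ### Exponential vectors -/

/-- The one-particle space `ℓ²(ℕ)` over `ℂ`. -/
abbrev Ell2 : Type := lp (fun _ : ℕ => ℂ) 2

/-- The sequence `ε_{z_0}, …, ε_{z_{n-1}}, vacuum, vacuum, …`. -/
def truncSeq (z : ℕ → ℂ) (n : ℕ) : StabSeq :=
  ⟨fun j => if j < n then expVec (z j) else vacuum,
    (Set.finite_lt_nat n).subset fun j hj => by
      by_contra h
      exact hj (if_neg h)⟩

/-- The exponential vector `ε_z = lim_n ε_{z_0} ⊗ ⋯ ⊗ ε_{z_{n-1}} ⊗ vacuum ⊗ ⋯` of `𝗁`. -/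
def expVector (z : Ell2) : ModeSpace := limUnder atTop fun n => tensorVec (truncSeq z n)

lemma inner_truncSeq (z w : ℕ → ℂ) (n m : ℕ) :
    inner ℂ (tensorVec (truncSeq z n)) (tensorVec (truncSeq w m)) =
      Complex.exp (∑ j ∈ Finset.range (min n m), conj (z j) * w j) := by
  rw [inner_tensorVec, stabKernel_eq_prod _ _ (Finset.range (max n m)), Complex.exp_sum]
  · rw [← Finset.prod_subset (s₁ := Finset.range (min n m))]
    · refine Finset.prod_congr rfl fun j hj => ?_
      have := Finset.mem_range.mp hj
      simp only [truncSeq]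
      rw [if_pos (by omega), if_pos (by omega), inner_expVec]
    · exact Finset.range_subset_range.mpr (by omega)
    · intro j hj hj'
      simp only [Finset.mem_range] at hj hj'
      simp only [truncSeq, ← expVec_zero]
      split_ifs with h1 h2
      · omega
      · rw [inner_expVec]; simp
      · rw [inner_expVec]; simp
      · rw [inner_expVec]; simp
  · intro j hj
    simp only [Finset.mem_range] at hj
    simp only [truncSeq]
    rw [if_neg (by omega)]
  · intro j hj
    simp only [Finset.mem_range] at hj
    simp only [truncSeq]
    rw [if_neg (by omega)]

lemma tendsto_sum_conj_mul (z w : Ell2) :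
    Tendsto (fun n => ∑ j ∈ Finset.range n, conj (z j) * w j) atTop (𝓝 (inner ℂ z w)) := by
  have := (lp.hasSum_inner (𝕜 := ℂ) z w).tendsto_sum_nat
  simpa [RCLike.inner_apply, mul_comm] using this

lemma tendsto_inner_trunc (z w : Ell2) :
    Tendsto (fun p : ℕ × ℕ => inner ℂ (tensorVec (truncSeq z p.1)) (tensorVec (truncSeq w p.2)))
      (atTop ×ˢ atTop) (𝓝 (Complex.exp (inner ℂ z w))) := by
  simp_rw [inner_truncSeq]
  refine (Complex.continuous_exp.tendsto _).comp ((tendsto_sum_conj_mul z w).comp ?_)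
  rw [tendsto_atTop]
  intro b
  filter_upwards [tendsto_fst.eventually (eventually_ge_atTop b),
    tendsto_snd.eventually (eventually_ge_atTop b)] with p h1 h2
  exact le_min h1 h2

lemma tendsto_expVector (z : Ell2) :
    Tendsto (fun n => tensorVec (truncSeq z n)) atTop (𝓝 (expVector z)) := by
  refine CauchySeq.tendsto_limUnder ?_
  rw [cauchySeq_iff_tendsto_dist_atTop_0, ← prod_atTop_atTop_eq]
  have h := tendsto_inner_trunc z z
  have h11 := h.comp (tendsto_fst.prodMk tendsto_fst (f := (atTop ×ˢ atTop : Filter (ℕ × ℕ))))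
  have h22 := h.comp (tendsto_snd.prodMk tendsto_snd (f := (atTop ×ˢ atTop : Filter (ℕ × ℕ))))
  have h12 := h
  have h21 := h.comp (tendsto_snd.prodMk tendsto_fst (f := (atTop ×ˢ atTop : Filter (ℕ × ℕ))))
  have hh := (((h11.sub h12).sub h21).add h22)
  have hre := (Complex.continuous_re.tendsto _).comp hh
  have hs := (Real.continuous_sqrt.tendsto _).comp hre
  simp only [sub_self, zero_sub, neg_add_cancel, Complex.zero_re, Real.sqrt_zero] at hs
  refine hs.congr fun p => ?_
  simp only [Function.comp_apply, dist_eq_norm]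
  rw [← Real.sqrt_sq (norm_nonneg (tensorVec _ - tensorVec _)), ← inner_self_eq_norm_sq (𝕜 := ℂ)]
  simp only [inner_sub_left, inner_sub_right]
  congr 1
  simp only [RCLike.re_to_complex]
  congr 1
  ring

lemma inner_expVector (z w : Ell2) :
    inner ℂ (expVector z) (expVector w) = Complex.exp (inner ℂ z w) := by
  have h1 := ((tendsto_expVector z).prodMk_nhds (tendsto_expVector w))
  have h2 : Tendsto (fun n => inner ℂ (tensorVec (truncSeq z n)) (tensorVec (truncSeq w n))) atTop
      (𝓝 (inner ℂ (expVector z) (expVector w))) := (tendsto_expVector z).inner (tendsto_expVector w)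
  have h3 := (tendsto_inner_trunc z w).comp (tendsto_id.prodMk tendsto_id (f := (atTop : Filter ℕ)))
  exact tendsto_nhds_unique h2 h3

/-! ### Totality of the exponential vectors -/

/-- Replace the `k`-th factor. -/
def StabSeq.upd (v : StabSeq) (k : ℕ) (x : L2R) : StabSeq where
  seq := Function.update v.seq k x
  finite := (v.finite.insert k).subset fun j hj => by
    by_cases h : j = k
    · exact Or.inl h
    · right
      simpa [Function.update_of_ne h] using hj

lemma stabKernel_upd (w v : StabSeq) (k : ℕ) (x : L2R) :
    stabKernel w (v.upd k x) =
      inner ℂ (w.seq k) x * stabKernel (w.upd k vacuum) (v.upd k vacuum) := by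
  classical
  set T : Finset ℕ := w.finite.toFinset ∪ v.finite.toFinset with hT
  have h1 : ∀ j ∉ T, w.seq j = vacuum := by
    intro j hj; by_contra h; exact hj (by simp [hT, h])
  have h2 : ∀ j ∉ T, v.seq j = vacuum := by
    intro j hj; by_contra h; exact hj (by simp [hT, h])
  have e : ∀ (u : StabSeq) (y : L2R), (∀ j ∉ T, u.seq j = vacuum) →
      ∀ j ∉ insert k T, (u.upd k y).seq j = vacuum := by
    intro u y hu j hj
    simp only [Finset.mem_insert, not_or] at hj
    simp [StabSeq.upd, Function.update_of_ne hj.1, hu j hj.2]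
  have h1' : ∀ j ∉ insert k T, w.seq j = vacuum := fun j hj =>
    h1 j fun h => hj (Finset.mem_insert_of_mem h)
  rw [stabKernel_eq_prod w _ (insert k T) h1' (e v x h2),
    stabKernel_eq_prod _ _ (insert k T) (e w vacuum h1) (e v vacuum h2),
    ← Finset.mul_prod_erase _ _ (Finset.mem_insert_self k T),
    ← Finset.mul_prod_erase (insert k T) (fun j => inner ℂ ((w.upd k vacuum).seq j) _)
      (Finset.mem_insert_self k T)]
  have h3 : ∀ y, (v.upd k y).seq k = y := fun y => by simp [StabSeq.upd]
  have h4 : ∀ y, (w.upd k y).seq k = y := fun y => by simp [StabSeq.upd]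
  rw [h3, h3, h4, inner_vacuum, one_mul]
  congr 1
  refine Finset.prod_congr rfl fun j hj => ?_
  have hne := Finset.ne_of_mem_erase hj
  simp [StabSeq.upd, Function.update_of_ne hne]

lemma tensorVec_ext {f g : ModeSpace}
    (h : ∀ v, inner ℂ (tensorVec v) f = inner ℂ (tensorVec v) g) : f = g := by
  rw [← sub_eq_zero]
  exact eq_zero_of_inner_tensorVec _ fun v => by rw [inner_sub_right, h, sub_self]

/-- The `k`-th factor as a variable. -/
def insertFactor (v : StabSeq) (k : ℕ) : L2R →L[ℂ] ModeSpace :=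
  LinearMap.mkContinuous
    { toFun := fun x => tensorVec (v.upd k x)
      map_add' := fun x y => tensorVec_ext fun w => by
        rw [inner_add_right, inner_tensorVec, inner_tensorVec, inner_tensorVec, stabKernel_upd w v,
          stabKernel_upd w v k x, stabKernel_upd w v k y, inner_add_right, add_mul]
      map_smul' := fun c x => tensorVec_ext fun w => by
        rw [inner_smul_right, inner_tensorVec, inner_tensorVec, stabKernel_upd w v,
          stabKernel_upd w v k x, inner_smul_right, mul_assoc, RingHom.id_apply] }
    ‖tensorVec (v.upd k vacuum)‖ (fun x => by
      have h : ‖tensorVec (v.upd k x)‖ ^ 2 = (‖tensorVec (v.upd k vacuum)‖ * ‖x‖) ^ 2 := by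
        have : ((‖tensorVec (v.upd k x)‖ : ℂ)) ^ 2 =
            ((‖tensorVec (v.upd k vacuum)‖ : ℂ) * ‖x‖) ^ 2 := by
          have e1 := inner_self_eq_norm_sq_to_K (𝕜 := ℂ) (tensorVec (v.upd k x))
          have e2 := inner_self_eq_norm_sq_to_K (𝕜 := ℂ) (tensorVec (v.upd k vacuum))
          have e3 := inner_self_eq_norm_sq_to_K (𝕜 := ℂ) x
          simp only [Complex.coe_algebraMap] at e1 e2 e3
          rw [mul_pow, ← e1, ← e2, ← e3, inner_tensorVec, inner_tensorVec, stabKernel_upd,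
            mul_comm]
          have h5 : (v.upd k x).upd k vacuum = v.upd k vacuum := by
            simp [StabSeq.upd]
          have h6 : (v.upd k x).seq k = x := by simp [StabSeq.upd]
          rw [h5, h6]
        exact_mod_cast this
      exact ((sq_eq_sq₀ (norm_nonneg _) (by positivity)).mp h).le)

lemma insertFactor_apply (v : StabSeq) (k : ℕ) (x : L2R) :
    insertFactor v k x = tensorVec (v.upd k x) := rfl

lemma expVector_of_finite (z : Ell2) (n : ℕ) (hz : ∀ j, n ≤ j → z j = 0) :
    expVector z = tensorVec (truncSeq z n) := by
  refine tendsto_nhds_unique (tendsto_expVector z) ?_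
  refine tendsto_const_nhds.congr' ?_
  filter_upwards [eventually_ge_atTop n] with m hm
  congr 1
  simp only [truncSeq]
  congr 1
  ext1 j
  split_ifs with h1 h2 h2
  · rfl
  · omega
  · rw [hz j (by omega), expVec_zero]
  · rfl

/-- The exponential vectors are total in `𝗁`. -/
lemma eq_zero_of_inner_expVector (f : ModeSpace) (hf : ∀ z, inner ℂ (expVector z) f = 0) :
    f = 0 := by
  classical
  have h0 : ∀ (z : ℕ → ℂ) (n : ℕ), inner ℂ (tensorVec (truncSeq z n)) f = 0 := by
    intro z n
    have hm : Memℓp (fun j => if j < n then z j else 0) 2 := by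
      refine (memℓp_zero ?_).of_exponent_ge bot_le
      refine (Set.finite_lt_nat n).subset fun j hj => ?_
      by_contra h
      exact hj (if_neg h)
    have := expVector_of_finite ⟨_, hm⟩ n (fun j hj => if_neg (by omega))
    rw [← hf ⟨_, hm⟩, this]
    congr 2
    simp only [truncSeq]
    congr 1
    ext1 j
    split_ifs with h1
    · rfl
    · rfl
  have h1 : ∀ (n k : ℕ), k ≤ n → ∀ v : StabSeq, (∀ j, n ≤ j → v.seq j = vacuum) →
      (∀ j, k ≤ j → j < n → ∃ z, v.seq j = expVec z) → inner ℂ (tensorVec v) f = 0 := by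
    intro n k
    induction k with
    | zero =>
      intro _ v hv hz
      have : ∀ j, ∃ z, j < n → v.seq j = expVec z := by
        intro j
        by_cases h : j < n
        · obtain ⟨z, hz⟩ := hz j (Nat.zero_le _) h
          exact ⟨z, fun _ => hz⟩
        · exact ⟨0, fun h' => absurd h' h⟩
      choose z hz using this
      rw [← h0 z n]
      congr 2
      obtain ⟨s, hs⟩ := v
      simp only [truncSeq, StabSeq.mk.injEq]
      ext1 j
      split_ifs with h
      · exact hz j h
      · exact hv j (by omega)
    | succ k ih =>
      intro hk v hv hz
      have h2 : ContinuousLinearMap.adjoint (insertFactor v k) f = 0 := by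
        refine eq_zero_of_inner_expVec _ fun z => ?_
        rw [ContinuousLinearMap.adjoint_inner_right, insertFactor_apply]
        refine ih (by omega) _ ?_ ?_
        · intro j hj
          have hne : j ≠ k := by omega
          simp [StabSeq.upd, Function.update_of_ne hne, hv j hj]
        · intro j hj hj'
          by_cases hne : j = k
          · subst hne
            exact ⟨z, by simp [StabSeq.upd]⟩
          · simp only [StabSeq.upd, Function.update_of_ne hne]
            exact hz j (by omega) hj'
      have h3 : v.upd k (v.seq k) = v := by simp [StabSeq.upd]
      rw [← h3, ← insertFactor_apply, ← ContinuousLinearMap.adjoint_inner_right, h2,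
        inner_zero_right]
  refine eq_zero_of_inner_tensorVec f fun v => ?_
  obtain ⟨n, hn⟩ := v.finite.bddAbove
  refine h1 (n + 1) (n + 1) le_rfl v ?_ ?_
  · intro j hj
    by_contra h
    have := hn h
    omega
  · intro j hj hj'
    omega

/-! ### Weyl operators -/

/-- The linear combinations of exponential vectors. -/
def expComb : (Ell2 →₀ ℂ) →ₗ[ℂ] ModeSpace := Finsupp.linearCombination ℂ expVector

lemma denseRange_expComb : DenseRange expComb := by
  have h : (LinearMap.range expComb).topologicalClosure = ⊤ := by
    rw [Submodule.topologicalClosure_eq_top_iff, Submodule.eq_bot_iff]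
    intro f hf
    refine eq_zero_of_inner_expVector f fun z => ?_
    refine (Submodule.mem_orthogonal _ _).mp hf _ ⟨Finsupp.single z 1, ?_⟩
    simp [expComb]
  have h2 := Submodule.dense_iff_topologicalClosure_eq_top.mpr h
  exact h2

/-- The factor `e^{-‖z‖²/2 - ⟨z,u⟩}`. -/
def weylFactor (z u : Ell2) : ℂ := Complex.exp (-(‖z‖ : ℂ) ^ 2 / 2 - inner ℂ z u)

lemma inner_weyl_expVector (z u v : Ell2) :
    inner ℂ (weylFactor z u • expVector (z + u)) (weylFactor z v • expVector (z + v)) =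
      inner ℂ (expVector u) (expVector v) := by
  rw [inner_smul_left, inner_smul_right, inner_expVector, inner_expVector, weylFactor, weylFactor,
    ← Complex.exp_conj, ← Complex.exp_add, ← Complex.exp_add]
  congr 1
  have e := inner_self_eq_norm_sq_to_K (𝕜 := ℂ) z
  simp only [Complex.coe_algebraMap] at e
  simp only [inner_add_left, inner_add_right, map_sub, map_div₀, map_neg, map_pow,
    Complex.conj_ofReal, inner_conj_symm, Complex.conj_ofNat, e]
  ring

/-- The map `ε_u ↦ e^{-‖z‖²/2 - ⟨z,u⟩} ε_{z+u}` extended linearly. -/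
def weylComb (z : Ell2) : (Ell2 →₀ ℂ) →ₗ[ℂ] ModeSpace :=
  Finsupp.linearCombination ℂ fun u => weylFactor z u • expVector (z + u)

lemma inner_weylComb (z : Ell2) (f g : Ell2 →₀ ℂ) :
    inner ℂ (weylComb z f) (weylComb z g) = inner ℂ (expComb f) (expComb g) := by
  simp only [weylComb, expComb, Finsupp.linearCombination_apply, Finsupp.sum, sum_inner, inner_sum]
  refine Finset.sum_congr rfl fun u _ => Finset.sum_congr rfl fun v _ => ?_
  rw [inner_smul_left, inner_smul_right, inner_weyl_expVector, inner_smul_left (expVector _),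
    inner_smul_right (expVector _)]

lemma norm_weylComb (z : Ell2) (f : Ell2 →₀ ℂ) : ‖weylComb z f‖ = ‖expComb f‖ := by
  rw [@norm_eq_sqrt_re_inner ℂ, @norm_eq_sqrt_re_inner ℂ _ _ _ _ (expComb f), inner_weylComb]

/-- Continuous extension of `weylComb`. -/
def weylExt (z : Ell2) : ModeSpace →L[ℂ] ModeSpace := (weylComb z).extendOfNorm expComb

lemma weylExt_expComb (z : Ell2) (f : Ell2 →₀ ℂ) : weylExt z (expComb f) = weylComb z f :=
  LinearMap.extendOfNorm_eq denseRange_expComb ⟨1, fun x => by rw [norm_weylComb, one_mul]⟩ f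

lemma weylExt_expVector (z u : Ell2) :
    weylExt z (expVector u) = weylFactor z u • expVector (z + u) := by
  have := weylExt_expComb z (Finsupp.single u 1)
  simpa [expComb, weylComb] using this

lemma clm_ext_expVector {A B : ModeSpace →L[ℂ] ModeSpace}
    (h : ∀ u, A (expVector u) = B (expVector u)) : A = B := by
  refine ContinuousLinearMap.coeFn_injective
    (denseRange_expComb.equalizer A.continuous B.continuous (funext fun f => ?_))
  simp only [Function.comp_apply, expComb, Finsupp.linearCombination_apply, Finsupp.sum, map_sum,
    map_smul, h]

lemma weylExt_mul_neg (z : Ell2) : weylExt z * weylExt (-z) = 1 := by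
  refine clm_ext_expVector fun u => ?_
  rw [mul_apply_eq_comp, weylExt_expVector, map_smul, weylExt_expVector, smul_smul,
    add_neg_cancel_left, weylFactor, weylFactor, ← Complex.exp_add]
  have e := inner_self_eq_norm_sq_to_K (𝕜 := ℂ) z
  simp only [Complex.coe_algebraMap] at e
  have : -((‖-z‖ : ℝ) : ℂ) ^ 2 / 2 - inner ℂ (-z) u + (-(‖z‖ : ℂ) ^ 2 / 2 - inner ℂ z (-z + u)) = 0 := by
    simp only [norm_neg, inner_neg_left, inner_add_right, inner_neg_right, e]
    ring
  rw [this, Complex.exp_zero, one_smul]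
  rfl

lemma adjoint_weylExt_mul (z : Ell2) : star (weylExt z) * weylExt z = 1 := by
  refine (ContinuousLinearMap.norm_map_iff_adjoint_comp_self _).mp fun f => ?_
  refine denseRange_expComb.induction_on (p := fun f => ‖weylExt z f‖ = ‖f‖) f ?_ ?_
  · exact isClosed_eq (by fun_prop) (by fun_prop)
  · intro g
    rw [weylExt_expComb, norm_weylComb]

/-- Existence of the Weyl operators; uniqueness is `clm_ext_expVector`. -/
theorem exists_weyl (z : Ell2) : ∃ U : ModeSpace →L[ℂ] ModeSpace,
    U ∈ unitary (ModeSpace →L[ℂ] ModeSpace) ∧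
    ∀ u, U (expVector u) =
      Complex.exp (-(‖z‖ : ℂ) ^ 2 / 2 - inner ℂ z u) • expVector (z + u) := by
  refine ⟨weylExt z, ?_, weylExt_expVector z⟩
  have h1 := adjoint_weylExt_mul z
  have h2 := weylExt_mul_neg z
  have h3 : star (weylExt z) = weylExt (-z) := by
    calc star (weylExt z) = star (weylExt z) * (weylExt z * weylExt (-z)) := by rw [h2, mul_one]
      _ = weylExt (-z) := by rw [← mul_assoc, h1, one_mul]
  exact Unitary.mem_iff.mpr ⟨h1, by rw [h3, h2]⟩

/-- The Weyl operator `W_z`: the unique unitary operator on `𝗁` with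
`W_z ε_u = e^{-‖z‖²/2 - ⟨z,u⟩} ε_{z+u}` for all `u`. -/
def weyl (z : Ell2) : ModeSpace →L[ℂ] ModeSpace := Classical.choose (exists_weyl z)

lemma weyl_mem_unitary (z : Ell2) : weyl z ∈ unitary (ModeSpace →L[ℂ] ModeSpace) :=
  (Classical.choose_spec (exists_weyl z)).1

lemma weyl_expVector (z u : Ell2) : weyl z (expVector u) =
    Complex.exp (-(‖z‖ : ℂ) ^ 2 / 2 - inner ℂ z u) • expVector (z + u) :=
  (Classical.choose_spec (exists_weyl z)).2 u

/-! ### Unbounded operators and unitary groups -/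

section General

variable {H : Type*} [NormedAddCommGroup H] [InnerProductSpace ℂ H]

/-- For a one-parameter group `U`, the operator `A` with `U t = e^{-itA}`: its domain consists of
the `x` for which `t ↦ U t x` is differentiable at `0`, and `A x = i (d/dt) U t x` at `t = 0`. -/
def generator (U : ℝ → H →L[ℂ] H) : H →ₗ.[ℂ] H where
  domain :=
    { carrier := {x | DifferentiableAt ℝ (fun t => U t x) 0}
      add_mem' := fun {x y} hx hy => by
        simp only [Set.mem_ofPred_eq, map_add] at *
        exact hx.add hy
      zero_mem' := by simp
      smul_mem' := fun c x hx => by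
        simp only [Set.mem_ofPred_eq, map_smul] at *
        exact hx.const_smul c }
  toFun :=
    { toFun := fun x => Complex.I • deriv (fun t => U t x) 0
      map_add' := fun x y => by
        have h : (fun t => U t ((x + y : _) : H)) = (fun t => U t (x : H)) + fun t => U t (y : H) := by
          funext t; simp
        rw [h, deriv_add x.2 y.2, smul_add]
      map_smul' := fun c x => by
        have h : (fun t => U t ((c • x : _) : H)) = c • fun t => U t (x : H) := by
          funext t; simp
        rw [h, deriv_const_smul c x.2, RingHom.id_apply, smul_comm] }

/-- The operator `A - c I`, with the domain of `A`. -/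
def subScalar (A : H →ₗ.[ℂ] H) (c : ℂ) : H →ₗ.[ℂ] H where
  domain := A.domain
  toFun := A.toFun - c • A.domain.subtype

/-- `R = (I + ε Λ)⁻¹`: `R` is a bounded two-sided inverse of `I + ε Λ : dom Λ → H`. -/
def IsResolvent (Λ : H →ₗ.[ℂ] H) (ε : ℝ) (R : H →L[ℂ] H) : Prop :=
  (∀ x, ∃ h : R x ∈ Λ.domain, R x + (ε : ℂ) • Λ ⟨R x, h⟩ = x) ∧
    ∀ y : Λ.domain, R ((y : H) + (ε : ℂ) • Λ y) = y

/-- `Y` is the Yosida approximation `Λ_ε = Λ (I + ε Λ)⁻¹`. -/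
def IsYosida (Λ : H →ₗ.[ℂ] H) (ε : ℝ) (Y : H →L[ℂ] H) : Prop :=
  ∃ R : H →L[ℂ] H, IsResolvent Λ ε R ∧ ∀ x, ∃ h : R x ∈ Λ.domain, Y x = Λ ⟨R x, h⟩

lemma IsYosida.unique {Λ : H →ₗ.[ℂ] H} {ε : ℝ} {Y Y' : H →L[ℂ] H}
    (h : IsYosida Λ ε Y) (h' : IsYosida Λ ε Y') : Y = Y' := by
  obtain ⟨R, hR, hY⟩ := h
  obtain ⟨R', hR', hY'⟩ := h'
  have : R = R' := by
    ext x
    obtain ⟨hx, e⟩ := hR'.1 x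
    have := hR.2 ⟨R' x, hx⟩
    rwa [e] at this
  subst this
  ext x
  obtain ⟨h1, e1⟩ := hY x
  obtain ⟨h2, e2⟩ := hY' x
  rw [e1, e2]

variable [CompleteSpace H]

/-- Strongly continuous one-parameter unitary groups. -/
structure IsUnitaryGroup (U : ℝ → H →L[ℂ] H) : Prop where
  unitary_mem : ∀ t, U t ∈ unitary (H →L[ℂ] H)
  map_add : ∀ s t, U (s + t) = U s * U t
  continuous_apply : ∀ x, Continuous fun t => U t x

/-- `U t = e^{itA}` for all `t`: `U` is the strongly continuous unitary group generated by `iA`. -/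
def IsUnitaryExp (A : H →ₗ.[ℂ] H) (U : ℝ → H →L[ℂ] H) : Prop :=
  IsUnitaryGroup U ∧ generator (fun t => U (-t)) = A

/-! ### Trace, states and moments -/

variable (H) in
/-- The index set of an orthonormal basis of `H`, fixed once and for all. -/
def basisIndex : Set H := Classical.choose (exists_hilbertBasis ℂ H)

variable (H) in
/-- An orthonormal basis of `H`, fixed once and for all. -/
def stdBasis : HilbertBasis (basisIndex H) ℂ H :=
  Classical.choose (Classical.choose_spec (exists_hilbertBasis ℂ H))

/-- `T` is of trace class: `∑ ⟨e_i, |T| e_i⟩ < ∞`. -/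
def IsTraceClass (T : H →L[ℂ] H) : Prop :=
  Summable fun i => inner ℂ (stdBasis H i) (CFC.abs T (stdBasis H i))

/-- The trace `∑ ⟨e_i, T e_i⟩` (meaningful for `T` of trace class). -/
def trace (T : H →L[ℂ] H) : ℂ := ∑' i, inner ℂ (stdBasis H i) (T (stdBasis H i))

/-- States: positive operators of trace class with trace one. -/
structure IsState (ρ : H →L[ℂ] H) : Prop where
  isPositive : ρ.IsPositive
  isTraceClass : IsTraceClass ρ
  trace_eq_one : trace ρ = 1

/-- The `n`-th moment of the observable `A` in the state `ρ` exists and equals `m`: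
`(-i)^n tr(ρ ((iA)_ε)^n) → m` as `ε → 0+`, where `(iA)_ε` is the Yosida approximation. -/
def HasMoment (ρ : H →L[ℂ] H) (A : H →ₗ.[ℂ] H) (n : ℕ) (m : ℂ) : Prop :=
  ∃ Y : ℝ → H →L[ℂ] H, (∀ ε, 0 < ε → IsYosida (Complex.I • A) ε (Y ε)) ∧
    Tendsto (fun ε => (-Complex.I) ^ n * trace (ρ * Y ε ^ n)) (𝓝[>] 0) (𝓝 m)

/-- The `n`-th moment of `A` in `ρ` in its derivative form: `t ↦ tr(ρ e^{itA})` is `n` times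
continuously differentiable near `0` and `(-i)^n (d/dt)^n tr(ρ e^{itA}) = m` at `t = 0`. -/
def HasDerivMoment (ρ : H →L[ℂ] H) (A : H →ₗ.[ℂ] H) (n : ℕ) (m : ℂ) : Prop :=
  ∃ U : ℝ → H →L[ℂ] H, IsUnitaryExp A U ∧
    ContDiffAt ℝ n (fun t => trace (ρ * U t)) 0 ∧
    (-Complex.I) ^ n * iteratedDeriv n (fun t => trace (ρ * U t)) 0 = m

end General

/-! ### Gaussian states -/

/-- The infinite-mode field operator `p(z)`, determined by `W_{tz} = e^{-itp(z)}`. -/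
def field (z : Ell2) : ModeSpace →ₗ.[ℂ] ModeSpace := generator fun t : ℝ => weyl ((t : ℂ) • z)

/-- The real inner product `(z, u) = Re ⟨z, u⟩` on `ℓ²(ℕ)`. -/
def realInner (z u : Ell2) : ℝ := (inner ℂ z u).re

/-- The non-commutative Fourier transform `π^{-1/2} tr(ρ W_z)`. -/
def qFourier (ρ : ModeSpace →L[ℂ] ModeSpace) (z : Ell2) : ℂ :=
  1 / (Real.sqrt Real.pi : ℂ) * trace (ρ * weyl z)

/-- `ρ = ρ(w, S)` is the Gaussian state with mean value vector `w` and covariance operator `S`, a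
bounded real-linear operator which is self-adjoint for the real inner product. -/
structure IsGaussianState (ρ : ModeSpace →L[ℂ] ModeSpace) (w : Ell2) (S : Ell2 →L[ℝ] Ell2) :
    Prop where
  isState : IsState ρ
  symm : ∀ u v, realInner (S u) v = realInner u (S v)
  qFourier_eq : ∀ z, qFourier ρ z = 1 / (Real.sqrt Real.pi : ℂ) *
    Complex.exp (-Complex.I * (realInner w z : ℂ) - 1 / 2 * (realInner z (S z) : ℂ))

/-- The centered field operator `p(z) - (w, z)`. -/
def centeredField (w z : Ell2) : ModeSpace →ₗ.[ℂ] ModeSpace :=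
  subScalar (field z) (realInner w z : ℂ)

end

end BosonGaussian

namespace BosonGaussian

noncomputable section

open MeasureTheory Filter Topology

/-! ### The functional `T ↦ tr(ρ T)` of a state -/

section TraceFunctional

variable {H : Type*} [NormedAddCommGroup H] [InnerProductSpace ℂ H]

/-! Put σ = (z, Sz), A = p(z) - (w,z) and V(t) = e^{it(w,z)} W_{tz} = e^{-itA}. The phase cancels
the mean, so the Gaussian formula reads tr(ρ V(t)) = e^{-σt²/2}
(`IsGaussianState.trace_mul_centeredWeyl`). The derivative form of the moments is thus the Taylor
expansion of a Gaussian at 0, computed by the Hermite recurrence (`iteratedDeriv_gaussFun_zero`).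

The Yosida form needs an argument, because neither ρ nor its vector components are known to lie in
the domain of A. With Λ = iA one has V(t) = e^{-tΛ}, and (1 + εΛ)⁻¹ = R = ∫ e^{-s} V(εs) ds over s >
0, so that Λ_ε = ε⁻¹(1 - R). Under tr(ρ V(t) ·), multiplication by R becomes the averaging operator
(E f)(t) = ∫ e^{-s} f(t + εs) ds. Integration by parts gives E f = f + ε E f', hence tr(ρ V(t)
Λ_ε^k) = (-1)^k (E^k F_k)(t), where F_k is the k-th derivative of tr(ρ V(t))
(`IsUnitaryGroup.trace_mul_yosida_pow`). Since E is a sup-norm contraction and F_{k+1} is bounded,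
E^k F_k → F_k as ε → 0+ (`tendsto_expAverage_pow`).

Two facts make this legitimate. Exchanging trace and integral rests on writing the state as tr(ρT) =
∑ ⟨x_i, T x_i⟩ with ∑ ‖x_i‖² = 1 (`IsState.exists_trace_eq`). Boundedness of every F_k requires σ ≥
0, which follows from |tr(ρ V(1))| ≤ 1. -/

lemma hasSum_norm_inner_hilbertBasis_sq {ι : Type*} (b : HilbertBasis ι ℂ H) (x : H) :
    HasSum (fun i => ‖inner ℂ (b i) x‖ ^ 2) (‖x‖ ^ 2) := by
  have h := b.hasSum_inner_mul_inner x x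
  have h2 := Complex.hasSum_re h
  have e : (inner ℂ x x).re = ‖x‖ ^ 2 := by
    rw [← inner_self_eq_norm_sq (𝕜 := ℂ) x]; rfl
  rw [e] at h2
  refine h2.congr_fun fun i => ?_
  rw [← inner_conj_symm x (b i), ← Complex.normSq_eq_conj_mul_self, Complex.normSq_eq_norm_sq,
    Complex.ofReal_re]

lemma norm_inner_apply_le (T : H →L[ℂ] H) (x : H) : ‖inner ℂ x (T x)‖ ≤ ‖T‖ * ‖x‖ ^ 2 := by
  calc ‖inner ℂ x (T x)‖ ≤ ‖x‖ * ‖T x‖ := norm_inner_le_norm _ _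
    _ ≤ ‖x‖ * (‖T‖ * ‖x‖) := by gcongr; exact T.le_opNorm x
    _ = _ := by ring

variable [CompleteSpace H]

/-- Cyclicity of the trace for a product of two Hilbert–Schmidt operators. -/
lemma tsum_inner_mul_comm {ι : Type*} (b : HilbertBasis ι ℂ H) (A B : H →L[ℂ] H)
    (hA : Summable fun i => ‖A (b i)‖ ^ 2)
    (hB : Summable fun i => ‖ContinuousLinearMap.adjoint B (b i)‖ ^ 2) :
    ∑' i, inner ℂ (b i) (A (B (b i))) = ∑' i, inner ℂ (b i) (B (A (b i))) := by
  -- By Parseval, the Hilbert–Schmidt sum is the double series of squared matrix coefficients.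
  have sq_summable : ∀ C : H →L[ℂ] H, Summable (fun i => ‖C (b i)‖ ^ 2) →
      Summable fun p : ι × ι => ‖inner ℂ (b p.2) (C (b p.1))‖ ^ 2 := by
    intro C hC
    rw [summable_prod_of_nonneg fun _ => by positivity]
    refine ⟨fun i => (hasSum_norm_inner_hilbertBasis_sq b (C (b i))).summable, ?_⟩
    refine hC.congr fun i => ?_
    exact (hasSum_norm_inner_hilbertBasis_sq b (C (b i))).tsum_eq.symm
  let a : ι × ι → ℂ := fun p => inner ℂ (b p.2) (A (b p.1)) * inner ℂ (b p.1) (B (b p.2))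
  have ha : Summable a := by
    refine Summable.of_norm_bounded (((sq_summable A hA).add (sq_summable _ hB))) fun p => ?_
    have : ‖inner ℂ (b p.1) (B (b p.2))‖ =
        ‖inner ℂ (b p.2) (ContinuousLinearMap.adjoint B (b p.1))‖ := by
      rw [ContinuousLinearMap.adjoint_inner_right, ← inner_conj_symm, RCLike.norm_conj]
    -- Both factors are square summable over pairs, so |xy| ≤ x² + y² gives absolute convergence;
    -- the claim is then an exchange of the two summations.
    rw [norm_mul, this]
    nlinarith [sq_nonneg (‖inner ℂ (b p.2) (A (b p.1))‖ -
      ‖inner ℂ (b p.2) (ContinuousLinearMap.adjoint B (b p.1))‖),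
      sq_nonneg (‖inner ℂ (b p.2) (A (b p.1))‖ +
      ‖inner ℂ (b p.2) (ContinuousLinearMap.adjoint B (b p.1))‖)]
  have h1 : ∀ i, ∑' j, a (i, j) = inner ℂ (b i) (B (A (b i))) := by
    intro i
    rw [← ContinuousLinearMap.adjoint_inner_left, ← b.tsum_inner_mul_inner]
    refine tsum_congr fun j => ?_
    rw [ContinuousLinearMap.adjoint_inner_left, mul_comm]
  have h2 : ∀ j, ∑' i, a (i, j) = inner ℂ (b j) (A (B (b j))) := by
    intro i
    rw [← ContinuousLinearMap.adjoint_inner_left, ← b.tsum_inner_mul_inner]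
    refine tsum_congr fun j => ?_
    rw [ContinuousLinearMap.adjoint_inner_left]
  simp_rw [← h1, ← h2]
  exact ha.tsum_comm

/-- A state is a mixture of vector states. -/
lemma IsState.exists_trace_eq {ρ : H →L[ℂ] H} (hρ : IsState ρ) :
    ∃ x : basisIndex H → H, HasSum (fun i => ‖x i‖ ^ 2) 1 ∧
      ∀ T : H →L[ℂ] H, trace (ρ * T) = ∑' i, inner ℂ (x i) (T (x i)) := by
  have h0 : 0 ≤ ρ := (ContinuousLinearMap.nonneg_iff_isPositive ρ).mpr hρ.isPositive
  set b := stdBasis H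
  -- The vectors are x_i = √ρ b_i. The trace-class hypothesis says exactly that √ρ is
  -- Hilbert–Schmidt.
  set Q : H →L[ℂ] H := CFC.sqrt ρ
  have hQ : IsSelfAdjoint Q := (CFC.sqrt_nonneg ρ).isSelfAdjoint
  have hQQ : Q * Q = ρ := CFC.sqrt_mul_sqrt_self ρ h0
  have hadj : ContinuousLinearMap.adjoint Q = Q := hQ
  have hin : ∀ u v, inner ℂ u (Q v) = inner ℂ (Q u) v := fun u v => by
    rw [← ContinuousLinearMap.adjoint_inner_left, hadj]
  have hterm : ∀ i, inner ℂ (b i) (ρ (b i)) = ((‖Q (b i)‖ ^ 2 : ℝ) : ℂ) := by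
    intro i
    rw [← hQQ, mul_apply_eq_comp, hin, inner_self_eq_norm_sq_to_K]
    norm_cast
  have hs : Summable fun i => ‖Q (b i)‖ ^ 2 := by
    have := hρ.isTraceClass
    rw [IsTraceClass, CFC.abs_of_nonneg ρ h0] at this
    exact Complex.summable_ofReal.mp (this.congr fun i => hterm i)
  have h1 : HasSum (fun i => ‖Q (b i)‖ ^ 2) 1 := by
    have h2 : trace ρ = ((∑' i, ‖Q (b i)‖ ^ 2 : ℝ) : ℂ) := by
      rw [trace, Complex.ofReal_tsum]
      exact tsum_congr hterm
    rw [hρ.trace_eq_one] at h2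
    have h3 : (∑' i, ‖Q (b i)‖ ^ 2) = 1 := by exact_mod_cast h2.symm
    exact h3 ▸ hs.hasSum
  refine ⟨fun i => Q (b i), h1, fun T => ?_⟩
  -- Writing ρT = Q(QT), cyclicity moves one square root to the right; (QT)* = T*Q is
  -- Hilbert–Schmidt because T* is bounded.
  have h2 := tsum_inner_mul_comm b Q (Q * T) hs (by
    have : ContinuousLinearMap.adjoint (Q * T) = ContinuousLinearMap.adjoint T * Q := by
      rw [← ContinuousLinearMap.star_eq_adjoint, star_mul, ContinuousLinearMap.star_eq_adjoint,
        ContinuousLinearMap.star_eq_adjoint, hadj]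
    rw [this]
    refine Summable.of_nonneg_of_le (fun _ => by positivity) (fun i => ?_)
      (hs.mul_left (‖ContinuousLinearMap.adjoint T‖ ^ 2))
    rw [← mul_pow]
    gcongr
    exact (ContinuousLinearMap.adjoint T).le_opNorm (Q (b i)))
  calc trace (ρ * T) = ∑' i, inner ℂ (b i) (Q ((Q * T) (b i))) := by rw [trace, ← hQQ]; rfl
    _ = ∑' i, inner ℂ (b i) ((Q * T) (Q (b i))) := h2
    _ = _ := tsum_congr fun i => by rw [mul_apply_eq_comp, hin]

lemma IsState.norm_trace_mul_le {ρ : H →L[ℂ] H} (hρ : IsState ρ) (T : H →L[ℂ] H) :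
    ‖trace (ρ * T)‖ ≤ ‖T‖ := by
  obtain ⟨x, hx, h⟩ := hρ.exists_trace_eq
  rw [h]
  have := hx.mul_left ‖T‖
  rw [mul_one] at this
  exact tsum_of_norm_bounded this fun i => norm_inner_apply_le T (x i)

/-- Additivity of `tsum` needs convergence, which the mixture representation supplies for every
bounded operator. -/
lemma IsState.trace_mul_sub {ρ : H →L[ℂ] H} (hρ : IsState ρ) (S T : H →L[ℂ] H) :
    trace (ρ * (S - T)) = trace (ρ * S) - trace (ρ * T) := by
  obtain ⟨x, hx, h⟩ := hρ.exists_trace_eq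
  have hs : ∀ T : H →L[ℂ] H, Summable fun i => inner ℂ (x i) (T (x i)) := fun T =>
    Summable.of_norm_bounded (hx.summable.mul_left ‖T‖) fun i => norm_inner_apply_le T (x i)
  rw [h, h, h, ← (hs S).tsum_sub (hs T)]
  simp

lemma trace_mul_smul (ρ T : H →L[ℂ] H) (c : ℂ) : trace (ρ * (c • T)) = c * trace (ρ * T) := by
  rw [trace, trace, ← tsum_mul_left]
  simp

/-- The functional `T ↦ tr(ρ T)` commutes with strong integrals of bounded families. -/
lemma IsState.trace_mul_eq_integral {ρ : H →L[ℂ] H} (hρ : IsState ρ) {α : Type*}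
    [MeasurableSpace α] {μ : Measure α} {g : α → ℝ} (hg : Integrable g μ) {T : α → H →L[ℂ] H}
    {C : ℝ} (hT : ∀ a, ‖T a‖ ≤ C) (hm : ∀ x, AEStronglyMeasurable (fun a => T a x) μ)
    {R : H →L[ℂ] H} (hR : ∀ x, R x = ∫ a, (g a : ℂ) • T a x ∂μ) :
    trace (ρ * R) = ∫ a, (g a : ℂ) * trace (ρ * T a) ∂μ := by
  obtain ⟨x, hx, h⟩ := hρ.exists_trace_eq
  -- The basis may be uncountable, but only countably many x_i are nonzero; exchanging sum and
  -- integral requires a countable index.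
  set s : Set (basisIndex H) := Function.support fun i => ‖x i‖ ^ 2
  have hs : s.Countable := hx.summable.countable_support
  have : Countable s := hs.to_subtype
  have hsub : ∀ T : H →L[ℂ] H, trace (ρ * T) = ∑' i : s, inner ℂ (x i) (T (x i)) := by
    intro T
    rw [h, tsum_subtype_eq_of_support_subset (f := fun i => inner ℂ (x i) (T (x i)))]
    intro i hi hi'
    refine hi ?_
    have : x i = 0 := by simpa using hi'
    simp [this]
  have hgm : AEStronglyMeasurable (fun a => (g a : ℂ)) μ :=
    Complex.continuous_ofReal.comp_aestronglyMeasurable hg.1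
  have hbd : ∀ (y : H) a, ‖(g a : ℂ) * inner ℂ y (T a y)‖ ≤ ‖g a‖ * (C * ‖y‖ ^ 2) := by
    intro y a
    rw [norm_mul, Complex.norm_real]
    gcongr
    refine (norm_inner_apply_le _ _).trans ?_
    gcongr
    exact hT a
  have hint : ∀ y, Integrable (fun a => (g a : ℂ) * inner ℂ y (T a y)) μ := by
    intro y
    refine Integrable.mono' (hg.norm.mul_const (C * ‖y‖ ^ 2))
      (hgm.mul (aestronglyMeasurable_const.inner (hm y))) (Eventually.of_forall (hbd y))
  have hintv : ∀ y, Integrable (fun a => (g a : ℂ) • T a y) μ := by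
    intro y
    refine Integrable.mono' (hg.norm.mul_const (C * ‖y‖))
      (hgm.smul (hm y)) (Eventually.of_forall fun a => ?_)
    rw [norm_smul, Complex.norm_real]
    gcongr
    exact (T a).le_of_opNorm_le (hT a) y
  have hterm : ∀ y, inner ℂ y (R y) = ∫ a, (g a : ℂ) * inner ℂ y (T a y) ∂μ := by
    intro y
    rw [hR, ← integral_inner (hintv y)]
    simp_rw [inner_smul_right]
  rw [hsub]
  simp_rw [hsub, hterm, ← tsum_mul_left]
  refine (hasSum_integral_of_summable_integral_norm (fun i : s => hint (x i)) ?_).tsum_eq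
  refine Summable.of_nonneg_of_le (fun _ => integral_nonneg fun _ => norm_nonneg _)
    (fun i => integral_mono (hint (x i)).norm (hg.norm.mul_const _) (hbd (x i))) ?_
  simp_rw [integral_mul_const]
  exact ((hx.summable.subtype s).mul_left C).mul_left _

end TraceFunctional

/-! ### Exponential averages of bounded functions -/

open scoped BoundedContinuousFunction

section Average

lemma integrable_exp_neg_smul {E : Type*} [NormedAddCommGroup E] [NormedSpace ℂ E] {g : ℝ → E}
    (hg : Continuous g) {C : ℝ} (hC : ∀ s, ‖g s‖ ≤ C) :
    IntegrableOn (fun s => (Real.exp (-s) : ℂ) • g s) (Set.Ioi 0) := by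
  have h := integrableOn_exp_neg_Ioi 0
  refine Integrable.mono' (h.mul_const C) ?_ (Eventually.of_forall fun s => ?_)
  · exact Continuous.aestronglyMeasurable (by fun_prop)
  · rw [norm_smul, Complex.norm_real, Real.norm_of_nonneg (Real.exp_pos _).le]
    gcongr
    exact hC s

lemma norm_integral_exp_neg_smul_le {E : Type*} [NormedAddCommGroup E] [NormedSpace ℂ E]
    {g : ℝ → E} {C : ℝ} (hC : ∀ s, ‖g s‖ ≤ C) :
    ‖∫ s in Set.Ioi (0 : ℝ), (Real.exp (-s) : ℂ) • g s‖ ≤ C := by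
  refine (norm_integral_le_of_norm_le ((integrableOn_exp_neg_Ioi 0).mul_const C)
    (Eventually.of_forall fun s => ?_)).trans_eq ?_
  · rw [norm_smul, Complex.norm_real, Real.norm_of_nonneg (Real.exp_pos _).le]
    gcongr
    exact hC s
  · rw [integral_mul_const, integral_exp_neg_Ioi_zero, one_mul]

lemma continuous_integral_exp_neg (ε : ℝ) (g : ℝ →ᵇ ℂ) :
    Continuous fun t => ∫ s in Set.Ioi (0 : ℝ), (Real.exp (-s) : ℂ) • g (t + ε * s) := by
  refine continuous_of_dominated (bound := fun s => Real.exp (-s) * ‖g‖) (fun t => ?_)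
    (fun t => Eventually.of_forall fun s => ?_) ((integrableOn_exp_neg_Ioi 0).mul_const _)
    (Eventually.of_forall fun s => ?_)
  · exact Continuous.aestronglyMeasurable (by fun_prop)
  · rw [norm_smul, Complex.norm_real, Real.norm_of_nonneg (Real.exp_pos _).le]
    gcongr
    exact g.norm_coe_le_norm _
  · fun_prop

/-- The average `t ↦ ∫ e^{-s} g(t + ε s) ds` over `s > 0`. -/
def expAverage (ε : ℝ) : (ℝ →ᵇ ℂ) →ₗ[ℂ] (ℝ →ᵇ ℂ) where
  toFun g := BoundedContinuousFunction.ofNormedAddCommGroup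
    (fun t => ∫ s in Set.Ioi (0 : ℝ), (Real.exp (-s) : ℂ) • g (t + ε * s))
    (continuous_integral_exp_neg ε g) ‖g‖
    (fun t => norm_integral_exp_neg_smul_le (g := fun s => g (t + ε * s))
      fun s => g.norm_coe_le_norm (t + ε * s))
  map_add' f g := by
    ext t
    simp only [BoundedContinuousFunction.coe_ofNormedAddCommGroup,
      BoundedContinuousFunction.coe_add, Pi.add_apply, smul_add]
    exact integral_add
      (integrable_exp_neg_smul (by fun_prop) fun s => f.norm_coe_le_norm (t + ε * s))
      (integrable_exp_neg_smul (by fun_prop) fun s => g.norm_coe_le_norm (t + ε * s))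
  map_smul' c g := by
    ext t
    simp only [BoundedContinuousFunction.coe_ofNormedAddCommGroup,
      BoundedContinuousFunction.coe_smul, RingHom.id_apply, smul_eq_mul]
    rw [← integral_const_mul]
    exact integral_congr_ae (Eventually.of_forall fun s => by ring)

lemma expAverage_apply (ε : ℝ) (g : ℝ →ᵇ ℂ) (t : ℝ) :
    expAverage ε g t = ∫ s in Set.Ioi (0 : ℝ), (Real.exp (-s) : ℂ) • g (t + ε * s) := rfl

lemma norm_expAverage_le (ε : ℝ) (g : ℝ →ᵇ ℂ) : ‖expAverage ε g‖ ≤ ‖g‖ :=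
  BoundedContinuousFunction.norm_ofNormedAddCommGroup_le _ (norm_nonneg _) fun t =>
    norm_integral_exp_neg_smul_le (g := fun s => g (t + ε * s))
      fun s => g.norm_coe_le_norm (t + ε * s)

/-- Integration by parts: the derivative falling on f produces the factor ε, and the boundary term
at s = 0 is f(t). In other words, the average inverts 1 - ε d/dt. -/
lemma expAverage_eq_add (ε : ℝ) {f g : ℝ →ᵇ ℂ} (h : ∀ t, HasDerivAt f (g t) t) :
    expAverage ε f = f + (ε : ℂ) • expAverage ε g := by
  ext t
  have hf := integrable_exp_neg_smul (g := fun s => f (t + ε * s)) (by fun_prop)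
    fun s => f.norm_coe_le_norm (t + ε * s)
  have hg := integrable_exp_neg_smul (g := fun s => g (t + ε * s)) (by fun_prop)
    fun s => g.norm_coe_le_norm (t + ε * s)
  have hd : ∀ s ∈ Set.Ici (0 : ℝ), HasDerivAt (fun s => -((Real.exp (-s) : ℂ) * f (t + ε * s)))
      ((Real.exp (-s) : ℂ) • f (t + ε * s) - (ε : ℂ) * ((Real.exp (-s) : ℂ) • g (t + ε * s))) s := by
    intro s _
    have h1 : HasDerivAt (fun s : ℝ => (Real.exp (-s) : ℂ)) ((-Real.exp (-s) : ℝ) : ℂ) s := by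
      have := ((hasDerivAt_neg s).exp).ofReal_comp
      simpa using this
    have h2 : HasDerivAt (fun s : ℝ => f (t + ε * s)) (ε • g (t + ε * s)) s := by
      have h3 : HasDerivAt (fun s : ℝ => t + ε * s) ε s := by
        simpa using ((hasDerivAt_id s).const_mul ε).const_add t
      exact (h (t + ε * s)).scomp s h3
    refine (h1.mul h2).neg.congr_deriv ?_
    simp only [smul_eq_mul, Complex.real_smul, Complex.ofReal_neg]
    ring
  have hlim : Tendsto (fun s => -((Real.exp (-s) : ℂ) * f (t + ε * s))) atTop (𝓝 0) := by
    refine squeeze_zero_norm (a := fun s => Real.exp (-s) * ‖f‖) (fun s => ?_) ?_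
    · rw [norm_neg, norm_mul, Complex.norm_real, Real.norm_of_nonneg (Real.exp_pos _).le]
      gcongr
      exact f.norm_coe_le_norm _
    · simpa using Real.tendsto_exp_neg_atTop_nhds_zero.mul_const ‖f‖
  have key := integral_Ioi_of_hasDerivAt_of_tendsto' hd (hf.sub (hg.const_mul (ε : ℂ))) hlim
  rw [integral_sub hf (hg.const_mul (ε : ℂ)), integral_const_mul] at key
  simp only [BoundedContinuousFunction.coe_add, BoundedContinuousFunction.coe_smul, Pi.add_apply,
    expAverage_apply, smul_eq_mul] at key ⊢
  rw [sub_eq_iff_eq_add] at key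
  rw [key]
  simp

/-- Telescoping: each further average moves f by ε times an average of f', and the averages already
applied are contractions. Only the first derivative enters. -/
lemma norm_expAverage_pow_sub_le {ε : ℝ} (hε : 0 ≤ ε) {f g : ℝ →ᵇ ℂ}
    (h : ∀ t, HasDerivAt f (g t) t) (k : ℕ) :
    ‖(expAverage ε ^ k) f - f‖ ≤ k * (ε * ‖g‖) := by
  have hk : ∀ (k : ℕ) (g : ℝ →ᵇ ℂ), ‖(expAverage ε ^ k) g‖ ≤ ‖g‖ := by
    intro k
    induction k with
    | zero => intro g; simp
    | succ k ih =>
      intro g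
      rw [pow_succ, Module.End.mul_apply]
      exact (ih _).trans (norm_expAverage_le _ _)
  induction k with
  | zero => simp
  | succ k ih =>
    have e : (expAverage ε ^ (k + 1)) f - f =
        (expAverage ε ^ k) ((ε : ℂ) • expAverage ε g) + ((expAverage ε ^ k) f - f) := by
      rw [pow_succ, Module.End.mul_apply, expAverage_eq_add ε h, map_add]
      abel
    rw [e]
    refine (norm_add_le _ _).trans ?_
    have : ‖(expAverage ε ^ k) ((ε : ℂ) • expAverage ε g)‖ ≤ ε * ‖g‖ := by
      refine (hk _ _).trans ?_
      rw [norm_smul, Complex.norm_real, Real.norm_of_nonneg hε]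
      gcongr
      exact norm_expAverage_le _ _
    push_cast
    linarith

lemma tendsto_expAverage_pow {f g : ℝ →ᵇ ℂ} (h : ∀ t, HasDerivAt f (g t) t) (k : ℕ) (t : ℝ) :
    Tendsto (fun ε => (expAverage ε ^ k) f t) (𝓝[>] 0) (𝓝 (f t)) := by
  rw [tendsto_iff_norm_sub_tendsto_zero]
  have hl : Tendsto (fun ε : ℝ => (k : ℝ) * (ε * ‖g‖)) (𝓝[>] 0) (𝓝 0) := by
    have : Continuous fun ε : ℝ => (k : ℝ) * (ε * ‖g‖) := by fun_prop
    simpa using (this.tendsto 0).mono_left nhdsWithin_le_nhds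
  refine squeeze_zero' (Eventually.of_forall fun _ => norm_nonneg _) ?_ hl
  filter_upwards [self_mem_nhdsWithin] with ε hε
  refine le_trans ?_ (norm_expAverage_pow_sub_le (le_of_lt hε) h k)
  exact ((expAverage ε ^ k) f - f).norm_coe_le_norm t

end Average

/-! ### The resolvent of a unitary group -/

section Resolvent

variable {H : Type*} [NormedAddCommGroup H] [InnerProductSpace ℂ H]

lemma generator_apply_eq {U : ℝ → H →L[ℂ] H} (x : (generator U).domain) :
    generator U x = Complex.I • deriv (fun t => U t (x : H)) 0 := rfl

variable [CompleteSpace H] {V : ℝ → H →L[ℂ] H}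

lemma IsUnitaryGroup.norm_apply (hV : IsUnitaryGroup V) (t : ℝ) (x : H) : ‖V t x‖ = ‖x‖ :=
  (ContinuousLinearMap.norm_map_iff_adjoint_comp_self _).mpr
    (Unitary.star_mul_self_of_mem (hV.unitary_mem t)) x

lemma IsUnitaryGroup.norm_le_one (hV : IsUnitaryGroup V) (t : ℝ) : ‖V t‖ ≤ 1 :=
  ContinuousLinearMap.opNorm_le_bound _ zero_le_one fun x => by rw [hV.norm_apply, one_mul]

lemma IsUnitaryGroup.zero (hV : IsUnitaryGroup V) : V 0 = 1 := by
  have h := hV.map_add 0 0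
  rw [add_zero] at h
  have h2 := Unitary.star_mul_self_of_mem (hV.unitary_mem 0)
  calc V 0 = star (V 0) * V 0 * V 0 := by rw [h2, one_mul]
    _ = star (V 0) * (V 0 * V 0) := mul_assoc _ _ _
    _ = 1 := by rw [← h, h2]

lemma IsUnitaryGroup.comp_neg (hV : IsUnitaryGroup V) : IsUnitaryGroup fun t => V (-t) where
  unitary_mem t := hV.unitary_mem _
  map_add s t := by rw [neg_add, hV.map_add]
  continuous_apply x := (hV.continuous_apply x).comp continuous_neg

lemma IsUnitaryGroup.integrable (hV : IsUnitaryGroup V) (ε : ℝ) (x : H) :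
    IntegrableOn (fun s => (Real.exp (-s) : ℂ) • V (ε * s) x) (Set.Ioi 0) :=
  integrable_exp_neg_smul ((hV.continuous_apply x).comp (by fun_prop))
    fun s => (hV.norm_apply (ε * s) x).le

/-- The operator `∫ e^{-s} V(ε s) ds`, the integral being over `s > 0`. -/
def IsUnitaryGroup.resolvent (hV : IsUnitaryGroup V) (ε : ℝ) : H →L[ℂ] H :=
  LinearMap.mkContinuous
    { toFun := fun x => ∫ s in Set.Ioi (0 : ℝ), (Real.exp (-s) : ℂ) • V (ε * s) x
      map_add' := fun x y => by
        simp only [_root_.map_add, smul_add]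
        exact integral_add (hV.integrable ε x) (hV.integrable ε y)
      map_smul' := fun c x => by
        simp only [map_smul, RingHom.id_apply]
        rw [← integral_smul]
        exact integral_congr_ae (Eventually.of_forall fun s => smul_comm _ _ _) }
    1 fun x => by
      rw [one_mul]
      exact norm_integral_exp_neg_smul_le fun s => (hV.norm_apply _ x).le

lemma IsUnitaryGroup.resolvent_apply (hV : IsUnitaryGroup V) (ε : ℝ) (x : H) :
    hV.resolvent ε x = ∫ s in Set.Ioi (0 : ℝ), (Real.exp (-s) : ℂ) • V (ε * s) x := rfl

lemma IsUnitaryGroup.apply_resolvent (hV : IsUnitaryGroup V) (ε t : ℝ) (x : H) :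
    V t (hV.resolvent ε x) =
      ∫ s in Set.Ioi (0 : ℝ), (Real.exp (-s) : ℂ) • V (t + ε * s) x := by
  rw [hV.resolvent_apply, ← (V t).integral_comp_comm (hV.integrable ε x)]
  simp_rw [map_smul, hV.map_add t, mul_apply_eq_comp]

lemma IsUnitaryGroup.resolvent_comm (hV : IsUnitaryGroup V) (ε t : ℝ) (x : H) :
    hV.resolvent ε (V t x) = V t (hV.resolvent ε x) := by
  rw [hV.apply_resolvent, hV.resolvent_apply]
  simp_rw [add_comm t, hV.map_add _ t, mul_apply_eq_comp]

/-- The vector x need not be in the domain of the generator. Translating the integration variable by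
t/ε moves the t-dependence out of V and into an exponential prefactor and the lower limit of
integration, where the fundamental theorem of calculus applies. -/
lemma IsUnitaryGroup.hasDerivAt_resolvent (hV : IsUnitaryGroup V) {ε : ℝ} (hε : 0 < ε) (x : H) :
    HasDerivAt (fun t => V t (hV.resolvent ε x)) (ε⁻¹ • (hV.resolvent ε x - x)) 0 := by
  set g : ℝ → H := fun s => (Real.exp (-s) : ℂ) • V (ε * s) x with hg
  have hgc : Continuous g := by
    have := (hV.continuous_apply x).comp (continuous_const_mul ε)
    exact Continuous.smul (by fun_prop) this
  have hgi : ∀ c, IntegrableOn g (Set.Ioi c) := fun c => by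
    refine Integrable.mono' ((integrableOn_exp_neg_Ioi c).mul_const ‖x‖)
      hgc.aestronglyMeasurable (Eventually.of_forall fun s => ?_)
    rw [hg, norm_smul, Complex.norm_real, Real.norm_of_nonneg (Real.exp_pos _).le, hV.norm_apply]
  have key : ∀ t, V t (hV.resolvent ε x) =
      Real.exp (ε⁻¹ * t) • (hV.resolvent ε x - ∫ s in (0 : ℝ)..(ε⁻¹ * t), g s) := by
    intro t
    have h1 : hV.resolvent ε x - ∫ s in (0 : ℝ)..(ε⁻¹ * t), g s =
        ∫ s in Set.Ioi (ε⁻¹ * t), g s := by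
      rw [hV.resolvent_apply, ← intervalIntegral.integral_interval_add_Ioi (hgi 0) (hgi (ε⁻¹ * t))]
      simp only [hg, add_sub_cancel_left]
    -- Substitution s ↦ s + t/ε: V(t + εs) becomes V at ε times the shifted variable, and e^{-s}
    -- picks up the factor e^{t/ε}.
    have h2 := (measurePreserving_add_right volume (ε⁻¹ * t)).setIntegral_preimage_emb
      (measurableEmbedding_addRight _) g (Set.Ioi (ε⁻¹ * t))
    rw [Set.preimage_add_const_Ioi, sub_self] at h2
    rw [h1, ← h2, ← integral_smul, hV.apply_resolvent]
    refine integral_congr_ae (Eventually.of_forall fun s => ?_)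
    simp only [hg]
    rw [← Complex.coe_smul, smul_smul, ← Complex.ofReal_mul, ← Real.exp_add]
    congr 3
    · ring
    · field_simp
      ring
  simp_rw [key]
  have hl : HasDerivAt (fun t : ℝ => ε⁻¹ * t) ε⁻¹ 0 := by
    simpa using (hasDerivAt_id (0 : ℝ)).const_mul ε⁻¹
  have h1 : HasDerivAt (fun t => Real.exp (ε⁻¹ * t)) ε⁻¹ 0 := by
    simpa using hl.exp
  have h2 : HasDerivAt (fun t => ∫ s in (0 : ℝ)..(ε⁻¹ * t), g s) (ε⁻¹ • x) 0 := by
    have h3 : HasDerivAt (fun u => ∫ s in (0 : ℝ)..u, g s) (g 0) (ε⁻¹ * 0) := by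
      rw [mul_zero]
      exact intervalIntegral.integral_hasDerivAt_right (hgc.intervalIntegrable _ _)
        (hgc.stronglyMeasurableAtFilter _ _) hgc.continuousAt
    have h4 : g 0 = x := by simp [hg, hV.zero]
    rw [h4] at h3
    exact h3.scomp 0 hl
  refine (h1.smul (h2.const_sub (hV.resolvent ε x))).congr_deriv ?_
  simp only [mul_zero, Real.exp_zero, one_smul, intervalIntegral.integral_same, sub_zero, smul_sub]
  abel

/-- The generator carries a factor i, so multiplying it by i again gives -d/dt at 0; this accounts
for the sign relative to `hasDerivAt_resolvent`. -/
lemma IsUnitaryGroup.generator_resolvent (hV : IsUnitaryGroup V) {ε : ℝ} (hε : 0 < ε) (x : H) :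
    ∃ h : hV.resolvent ε x ∈ (Complex.I • generator V).domain,
      (Complex.I • generator V) ⟨hV.resolvent ε x, h⟩ = (ε : ℂ)⁻¹ • (x - hV.resolvent ε x) := by
  have hd := hV.hasDerivAt_resolvent hε x
  refine ⟨hd.differentiableAt, ?_⟩
  rw [LinearPMap.smul_apply, generator_apply_eq]
  simp only
  rw [hd.deriv, smul_smul, Complex.I_mul_I, ← Complex.coe_smul, Complex.ofReal_inv, neg_smul,
    one_smul, ← smul_neg, neg_sub]

lemma IsUnitaryGroup.isResolvent (hV : IsUnitaryGroup V) {ε : ℝ} (hε : 0 < ε) :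
    IsResolvent (Complex.I • generator V) ε (hV.resolvent ε) := by
  have hne : (ε : ℂ) ≠ 0 := by exact_mod_cast hε.ne'
  refine ⟨fun x => ?_, fun y => ?_⟩
  · obtain ⟨h, e⟩ := hV.generator_resolvent hε x
    refine ⟨h, ?_⟩
    rw [e, smul_inv_smul₀ hne]
    abel
  -- For the left inverse, R V(t) y = V(t) R y is differentiated at 0 in two ways: through the
  -- bounded operator R, and by the formula for the derivative of V(t) R y.
  · have hy : HasDerivAt (fun t => V t (y : H)) (deriv (fun t => V t (y : H)) 0) 0 :=
      DifferentiableAt.hasDerivAt y.2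
    have h1 := ((hV.resolvent ε).restrictScalars ℝ).hasFDerivAt.comp_hasDerivAt (0 : ℝ) hy
    have h2 : HasDerivAt (fun t => V t (hV.resolvent ε y))
        (hV.resolvent ε (deriv (fun t => V t (y : H)) 0)) 0 := by
      refine h1.congr_of_eventuallyEq (Eventually.of_forall fun t => ?_)
      exact (hV.resolvent_comm ε t y).symm
    have h3 := h2.unique (hV.hasDerivAt_resolvent hε y)
    have h4 : (Complex.I • generator V) y = -deriv (fun t => V t (y : H)) 0 := by
      rw [LinearPMap.smul_apply, generator_apply_eq, smul_smul, Complex.I_mul_I, neg_one_smul]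
    rw [h4, _root_.map_add, map_smul, map_neg, h3, ← Complex.coe_smul, Complex.ofReal_inv, smul_neg,
      smul_inv_smul₀ hne]
    abel

/-- The Yosida approximation `ε⁻¹ (1 - R_ε)`. -/
def IsUnitaryGroup.yosida (hV : IsUnitaryGroup V) (ε : ℝ) : H →L[ℂ] H :=
  (ε : ℂ)⁻¹ • (1 - hV.resolvent ε)

lemma IsUnitaryGroup.isYosida (hV : IsUnitaryGroup V) {ε : ℝ} (hε : 0 < ε) :
    IsYosida (Complex.I • generator V) ε (hV.yosida ε) := by
  refine ⟨hV.resolvent ε, hV.isResolvent hε, fun x => ?_⟩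
  obtain ⟨h, e⟩ := hV.generator_resolvent hε x
  exact ⟨h, e.symm⟩

/-- Keeping t free is what makes the induction close: a factor R beside V(t) samples the previous
identity at all the times t + εs, which is one more average. Then ε⁻¹(1 - E) turns E^k F_k into
-E^{k+1} F_{k+1}. -/
lemma IsUnitaryGroup.trace_mul_yosida_pow (hV : IsUnitaryGroup V) {ρ : H →L[ℂ] H}
    (hρ : IsState ρ) {ε : ℝ} (hε : 0 < ε) {F : ℕ → ℝ →ᵇ ℂ}
    (hF : ∀ n t, HasDerivAt (F n) (F (n + 1) t) t) (h0 : ∀ t, F 0 t = trace (ρ * V t))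
    (k : ℕ) (t : ℝ) :
    trace (ρ * (V t * hV.yosida ε ^ k)) = (-1) ^ k * (expAverage ε ^ k) (F k) t := by
  have hne : (ε : ℂ) ≠ 0 := by exact_mod_cast hε.ne'
  induction k generalizing t with
  | zero => simp [h0]
  | succ k ih =>
    set P := hV.yosida ε ^ k with hP
    have h1 : V t * hV.yosida ε ^ (k + 1) =
        (ε : ℂ)⁻¹ • (V t * P - V t * hV.resolvent ε * P) := by
      rw [pow_succ', ← hP, IsUnitaryGroup.yosida, smul_mul_assoc, mul_smul_comm, sub_mul, mul_sub,
        one_mul, mul_assoc]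
    have h2 : trace (ρ * (V t * hV.resolvent ε * P)) =
        ∫ s in Set.Ioi (0 : ℝ), (Real.exp (-s) : ℂ) * trace (ρ * (V (t + ε * s) * P)) := by
      refine hρ.trace_mul_eq_integral (integrableOn_exp_neg_Ioi 0) (C := ‖P‖) (fun s => ?_)
        (fun x => ?_) fun x => ?_
      · refine (norm_mul_le _ _).trans ?_
        exact mul_le_of_le_one_left (norm_nonneg _) (hV.norm_le_one _)
      · exact ((hV.continuous_apply (P x)).comp
          (f := fun s => t + ε * s) (by fun_prop)).aestronglyMeasurable
      · rw [mul_apply_eq_comp, mul_apply_eq_comp, hV.apply_resolvent]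
        rfl
    have h3 : ∫ s in Set.Ioi (0 : ℝ), (Real.exp (-s) : ℂ) * trace (ρ * (V (t + ε * s) * P)) =
        (-1) ^ k * expAverage ε ((expAverage ε ^ k) (F k)) t := by
      rw [expAverage_apply, ← integral_const_mul]
      refine integral_congr_ae (Eventually.of_forall fun s => ?_)
      simp only [ih, smul_eq_mul]
      ring
    have h4 : expAverage ε ((expAverage ε ^ k) (F k)) =
        (expAverage ε ^ k) (F k) + (ε : ℂ) • (expAverage ε ^ (k + 1)) (F (k + 1)) := by
      rw [← Module.End.mul_apply, ← pow_succ', pow_succ, Module.End.mul_apply, Module.End.mul_apply,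
        expAverage_eq_add ε (hF k), _root_.map_add, map_smul]
    rw [h1, trace_mul_smul, hρ.trace_mul_sub, h2, h3, h4, ih]
    simp only [BoundedContinuousFunction.coe_add, BoundedContinuousFunction.coe_smul, Pi.add_apply,
      smul_eq_mul]
    field_simp
    ring

/-- If all derivatives of `t ↦ tr(ρ V(t))` are bounded, the moments of the generator of `V` exist
and are given by these derivatives. -/
lemma IsUnitaryGroup.hasMoment (hV : IsUnitaryGroup V) {ρ : H →L[ℂ] H} (hρ : IsState ρ)
    {F : ℕ → ℝ →ᵇ ℂ} (hF : ∀ n t, HasDerivAt (F n) (F (n + 1) t) t)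
    (h0 : ∀ t, F 0 t = trace (ρ * V t)) (n : ℕ) :
    HasMoment ρ (generator V) n ((-Complex.I) ^ n * ((-1) ^ n * F n 0)) := by
  refine ⟨hV.yosida, fun ε hε => hV.isYosida hε, ?_⟩
  have h := ((tendsto_expAverage_pow (hF n) n 0).const_mul ((-1) ^ n)).const_mul ((-Complex.I) ^ n)
  refine h.congr' ?_
  filter_upwards [self_mem_nhdsWithin] with ε hε
  rw [← hV.trace_mul_yosida_pow hρ hε hF h0, hV.zero, one_mul]

end Resolvent

/-! ### Derivatives of the Gaussian function -/

section Gaussian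

/-- The function `e^{-σ t²/2}`. -/
def gaussFun (σ t : ℝ) : ℂ := Complex.exp (-(σ * t ^ 2 / 2 : ℝ))

lemma contDiff_gaussFun (σ : ℝ) {n : WithTop ℕ∞} : ContDiff ℝ n (gaussFun σ) := by
  have h : ContDiff ℝ n fun t : ℝ => ((σ * t ^ 2 / 2 : ℝ) : ℂ) :=
    Complex.ofRealCLM.contDiff.comp
      (((contDiff_const (c := σ)).mul (contDiff_id.pow 2)).div_const 2)
  exact h.neg.cexp

lemma hasDerivAt_gaussFun (σ t : ℝ) : HasDerivAt (gaussFun σ) (-σ * t * gaussFun σ t) t := by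
  have h1 : HasDerivAt (fun t : ℝ => -(σ * t ^ 2 / 2)) (-σ * t) t := by
    have := (((hasDerivAt_pow 2 t).const_mul σ).div_const 2).neg
    refine this.congr_deriv ?_
    push_cast
    ring
  have h2 := h1.ofReal_comp.cexp
  refine (h2.congr_deriv ?_).congr_of_eventuallyEq (Eventually.of_forall fun t => ?_)
  · simp only [gaussFun]
    push_cast
    ring
  · simp [gaussFun]

lemma hasDerivAt_iteratedDeriv_gaussFun (σ : ℝ) (n : ℕ) (t : ℝ) :
    HasDerivAt (iteratedDeriv n (gaussFun σ)) (iteratedDeriv (n + 1) (gaussFun σ) t) t := by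
  rw [iteratedDeriv_succ]
  exact ((contDiff_gaussFun σ (n := n + 1)).differentiable_iteratedDeriv' n t).hasDerivAt

lemma iteratedDeriv_gaussFun_one (σ t : ℝ) :
    iteratedDeriv 1 (gaussFun σ) t = -σ * t * gaussFun σ t := by
  rw [iteratedDeriv_one, (hasDerivAt_gaussFun σ t).deriv]

/-- The Hermite recurrence: differentiate g' = -σ t g repeatedly; by Leibniz at most one derivative
falls on the factor t. -/
lemma iteratedDeriv_gaussFun_add_two (σ : ℝ) (n : ℕ) (t : ℝ) :
    iteratedDeriv (n + 2) (gaussFun σ) t = -σ * (t * iteratedDeriv (n + 1) (gaussFun σ) t +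
      (n + 1) * iteratedDeriv n (gaussFun σ) t) := by
  induction n generalizing t with
  | zero =>
    refine (hasDerivAt_iteratedDeriv_gaussFun σ 1 t).unique ?_
    have h : HasDerivAt (fun s : ℝ => -σ * s * gaussFun σ s)
        (-σ * 1 * gaussFun σ t + -σ * t * iteratedDeriv 1 (gaussFun σ) t) t := by
      have h0 := hasDerivAt_iteratedDeriv_gaussFun σ 0 t
      rw [iteratedDeriv_zero] at h0
      exact (((hasDerivAt_id t).ofReal_comp).const_mul (-σ : ℂ)).mul h0
    refine (h.congr_deriv ?_).congr_of_eventuallyEq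
      (Eventually.of_forall (iteratedDeriv_gaussFun_one σ))
    simp only [iteratedDeriv_zero, zero_add, Nat.cast_zero]
    ring
  | succ n ih =>
    refine (hasDerivAt_iteratedDeriv_gaussFun σ (n + 2) t).unique ?_
    have h := ((((hasDerivAt_id t).ofReal_comp).mul
      (hasDerivAt_iteratedDeriv_gaussFun σ (n + 1) t)).add
        ((hasDerivAt_iteratedDeriv_gaussFun σ n t).const_mul ((n : ℂ) + 1))).const_mul (-σ : ℂ)
    refine (h.congr_deriv ?_).congr_of_eventuallyEq (Eventually.of_forall ih)
    simp only [id, Complex.ofReal_one]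
    push_cast
    ring

lemma bounded_pow_mul_gaussFun {σ : ℝ} (hσ : 0 < σ) (j : ℕ) :
    ∃ C, ∀ t : ℝ, ‖(t : ℂ) ^ j * gaussFun σ t‖ ≤ C := by
  have hn : ∀ t, ‖gaussFun σ t‖ = Real.exp (-(σ / 2 * t ^ 2)) := by
    intro t
    rw [gaussFun, ← Complex.ofReal_neg, Complex.norm_exp_ofReal]
    congr 1
    ring
  -- With u = σt²/2, one has |t|^j ≤ 1 + t^{2j} = 1 + (2/σ)^j u^j, while u^j ≤ j! e^u and 1 ≤ e^u.
  refine ⟨1 + j.factorial * (2 / σ) ^ j, fun t => ?_⟩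
  rw [norm_mul, hn, norm_pow, Complex.norm_real, Real.norm_eq_abs, Real.exp_neg,
    ← div_eq_mul_inv, div_le_iff₀ (Real.exp_pos _)]
  have hu : 0 ≤ σ / 2 * t ^ 2 := by positivity
  have h1 := Real.one_le_exp hu
  have h2 := Real.pow_div_factorial_le_exp (σ / 2 * t ^ 2) hu j
  rw [div_le_iff₀ (by positivity)] at h2
  have h3 : |t| ^ j ≤ 1 + (t ^ 2) ^ j := by
    rcases le_total |t| 1 with h | h
    · have := pow_le_one₀ (n := j) (abs_nonneg t) h
      have : 0 ≤ (t ^ 2) ^ j := by positivity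
      linarith
    · have h4 : |t| ≤ t ^ 2 := by
        rw [← sq_abs]
        nlinarith
      have := pow_le_pow_left₀ (abs_nonneg t) h4 j
      linarith
  have h5 : (t ^ 2) ^ j = (2 / σ) ^ j * (σ / 2 * t ^ 2) ^ j := by
    rw [← mul_pow]
    congr 1
    field_simp
  have h6 : (2 / σ) ^ j * (σ / 2 * t ^ 2) ^ j ≤
      (2 / σ) ^ j * (Real.exp (σ / 2 * t ^ 2) * j.factorial) := by
    gcongr
  nlinarith

/-- The recurrence multiplies by t, so the induction must carry all polynomial weights at once. -/
lemma bounded_pow_mul_iteratedDeriv_gaussFun {σ : ℝ} (hσ : 0 < σ) (n : ℕ) :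
    ∀ j : ℕ, ∃ C, ∀ t : ℝ, ‖(t : ℂ) ^ j * iteratedDeriv n (gaussFun σ) t‖ ≤ C := by
  have step : ∀ f g h : ℝ → ℂ, ∀ a b : ℂ, (∃ C, ∀ t, ‖f t‖ ≤ C) → (∃ C, ∀ t, ‖g t‖ ≤ C) →
      (∀ t, h t = a * f t + b * g t) → ∃ C, ∀ t, ‖h t‖ ≤ C := by
    rintro f g h a b ⟨C, hC⟩ ⟨D, hD⟩ he
    refine ⟨‖a‖ * C + ‖b‖ * D, fun t => ?_⟩
    rw [he]
    refine (norm_add_le _ _).trans ?_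
    rw [norm_mul, norm_mul]
    gcongr
    · exact hC t
    · exact hD t
  induction n using Nat.twoStepInduction with
  | zero =>
    intro j
    simpa only [iteratedDeriv_zero] using bounded_pow_mul_gaussFun hσ j
  | one =>
    intro j
    refine step _ _ _ (-σ) 0 (bounded_pow_mul_gaussFun hσ (j + 1)) ⟨0, fun _ => norm_zero.le⟩
      fun t => ?_
    rw [iteratedDeriv_gaussFun_one]
    ring
  | more n ih0 ih1 =>
    intro j
    refine step _ _ _ (-σ) (-σ * (n + 1)) (ih1 (j + 1)) (ih0 j) fun t => ?_
    rw [iteratedDeriv_gaussFun_add_two]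
    ring

lemma bounded_iteratedDeriv_gaussFun {σ : ℝ} (hσ : 0 ≤ σ) (n : ℕ) :
    ∃ C, ∀ t : ℝ, ‖iteratedDeriv n (gaussFun σ) t‖ ≤ C := by
  -- For σ = 0 the Gaussian is the constant 1 and the polynomially weighted bounds fail, so this
  -- case is separate.
  rcases hσ.eq_or_lt with rfl | hσ
  · have h : gaussFun 0 = fun _ => 1 := by
      funext t
      simp [gaussFun]
    rw [h]
    refine ⟨1, fun t => ?_⟩
    rw [iteratedDeriv_const]
    split_ifs <;> simp
  · simpa using bounded_pow_mul_iteratedDeriv_gaussFun hσ n 0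

/-- At t = 0 the recurrence loses its first term and links derivatives of equal parity by the factor
-σ(n+1). -/
lemma iteratedDeriv_gaussFun_zero (σ : ℝ) (k : ℕ) :
    iteratedDeriv (2 * k + 1) (gaussFun σ) 0 = 0 ∧ iteratedDeriv (2 * k) (gaussFun σ) 0 =
      (-1) ^ k * ((σ ^ k * (Nat.doubleFactorial (2 * k - 1) : ℝ) : ℝ) : ℂ) := by
  induction k with
  | zero =>
    refine ⟨?_, ?_⟩
    · rw [mul_zero, zero_add, iteratedDeriv_gaussFun_one]
      simp
    · simp [gaussFun]
  | succ k ih =>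
    refine ⟨?_, ?_⟩
    · rw [show 2 * (k + 1) + 1 = 2 * k + 1 + 2 by ring, iteratedDeriv_gaussFun_add_two, ih.1]
      simp
    -- For k = 0 the truncated subtraction gives 0!! = 1, which agrees with the convention (-1)!! =
    -- 1.
    · have hd : Nat.doubleFactorial (2 * (k + 1) - 1) =
          (2 * k + 1) * Nat.doubleFactorial (2 * k - 1) := by
        cases k with
        | zero => simp
        | succ m =>
          rw [show 2 * (m + 1 + 1) - 1 = 2 * m + 1 + 2 by omega, Nat.doubleFactorial_add_two]
          rfl
      rw [show 2 * (k + 1) = 2 * k + 2 by ring, iteratedDeriv_gaussFun_add_two, ih.1, ih.2,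
        show 2 * k + 2 = 2 * (k + 1) by ring, hd]
      push_cast
      ring

end Gaussian

/-! ### Rescaled unitary groups and their generators -/

section Phase

variable {H : Type*} [NormedAddCommGroup H] [InnerProductSpace ℂ H]

lemma hasDerivAt_cexp_I_mul (c t : ℝ) :
    HasDerivAt (fun t : ℝ => Complex.exp (Complex.I * t * c))
      (Complex.I * c * Complex.exp (Complex.I * t * c)) t := by
  have h := ((((hasDerivAt_id t).ofReal_comp).const_mul Complex.I).mul_const (c : ℂ)).cexp
  refine h.congr_deriv ?_
  simp only [id, Complex.ofReal_one]
  ring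

lemma norm_cexp_I_mul (t c : ℝ) : ‖Complex.exp (Complex.I * t * c)‖ = 1 := by
  rw [show Complex.I * t * c = ((t * c : ℝ) : ℂ) * Complex.I by push_cast; ring,
    Complex.norm_exp_ofReal_mul_I]

/-- The phase is smooth and invertible, so differentiability at 0 is unaffected and the domains
agree; the product rule contributes i · ic = -c. -/
lemma generator_cexp_smul (U : ℝ → H →L[ℂ] H) (h0 : U 0 = 1) (c : ℝ) :
    generator (fun t => Complex.exp (Complex.I * t * c) • U t) = subScalar (generator U) c := by
  have hphase : ∀ c : ℝ, DifferentiableAt ℝ (fun t : ℝ => Complex.exp (Complex.I * t * c)) 0 :=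
    fun c => (hasDerivAt_cexp_I_mul c 0).differentiableAt
  refine LinearPMap.ext ?_ ?_
  · ext x
    change DifferentiableAt ℝ (fun t : ℝ => Complex.exp (Complex.I * t * c) • U t x) 0 ↔
      DifferentiableAt ℝ (fun t => U t x) 0
    refine ⟨fun h => ?_, fun h => (hphase c).smul h⟩
    refine ((hphase (-c)).smul h).congr_of_eventuallyEq (Eventually.of_forall fun t => ?_)
    rw [Pi.smul_apply', smul_smul, ← Complex.exp_add]
    simp
  · intro x hx hx'
    have hd : DifferentiableAt ℝ (fun t => U t x) 0 := hx'
    change Complex.I • deriv (fun t : ℝ => Complex.exp (Complex.I * t * c) • U t x) 0 =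
      Complex.I • deriv (fun t => U t x) 0 - (c : ℂ) • x
    have hd' : HasDerivAt (fun t : ℝ => Complex.exp (Complex.I * t * c) • U t x) _ 0 :=
      (hasDerivAt_cexp_I_mul c 0).smul hd.hasDerivAt
    rw [hd'.deriv]
    simp only [h0, one_apply_eq_self, Complex.ofReal_zero, mul_zero, zero_mul, Complex.exp_zero,
      one_smul, mul_one, smul_add, smul_smul, ← mul_assoc, Complex.I_mul_I, neg_mul, one_mul,
      neg_smul]
    abel

/-- Strong continuity of an isometric family can be checked on a dense set. -/
lemma continuous_apply_of_dense {U : ℝ → H →L[ℂ] H} (hU : ∀ t x, ‖U t x‖ = ‖x‖) {s : Set H}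
    (hs : Dense s) (hc : ∀ x ∈ s, Continuous fun t => U t x) (x : H) :
    Continuous fun t => U t x := by
  refine continuous_of_uniform_approx_of_continuous fun u hu => ?_
  obtain ⟨δ, hδ, h⟩ := Metric.mem_uniformity_dist.mp hu
  obtain ⟨y, hy, hxy⟩ := hs.exists_dist_lt x hδ
  refine ⟨_, hc y hy, fun t => h ?_⟩
  -- Isometry makes the approximation by a vector of the dense set uniform in t.
  rwa [dist_eq_norm, ← map_sub, hU, ← dist_eq_norm]

variable [CompleteSpace H]

lemma IsUnitaryGroup.cexp_smul {U : ℝ → H →L[ℂ] H} (hU : IsUnitaryGroup U) (c : ℝ) :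
    IsUnitaryGroup fun t => Complex.exp (Complex.I * t * c) • U t where
  unitary_mem t := by
    have h : conj (Complex.exp (Complex.I * t * c)) * Complex.exp (Complex.I * t * c) = 1 := by
      rw [← Complex.normSq_eq_conj_mul_self, Complex.normSq_eq_norm_sq, norm_cexp_I_mul]
      simp
    refine Unitary.mem_iff.mpr ⟨?_, ?_⟩
    · rw [star_smul, smul_mul_smul_comm, Unitary.star_mul_self_of_mem (hU.unitary_mem t)]
      rw [← starRingEnd_apply, h, one_smul]
    · rw [star_smul, smul_mul_smul_comm, Unitary.mul_star_self_of_mem (hU.unitary_mem t)]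
      rw [← starRingEnd_apply, mul_comm, h, one_smul]
  map_add s t := by
    rw [smul_mul_smul_comm, ← Complex.exp_add, hU.map_add]
    congr 2
    push_cast
    ring
  continuous_apply x :=
    Continuous.smul (f := fun t : ℝ => Complex.exp (Complex.I * t * c)) (by fun_prop)
      (hU.continuous_apply x)

end Phase

/-! ### The Weyl operators along a line -/

/-- The squared distance expands into values of the continuous kernel e^{⟨u,v⟩}. -/
lemma continuous_expVector : Continuous expVector := by
  rw [continuous_iff_continuousAt]
  intro v
  rw [ContinuousAt, tendsto_iff_norm_sub_tendsto_zero]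
  have h : ∀ u, ‖expVector u - expVector v‖ = Real.sqrt (Complex.exp (inner ℂ u u) -
      Complex.exp (inner ℂ u v) - Complex.exp (inner ℂ v u) + Complex.exp (inner ℂ v v)).re := by
    intro u
    rw [@norm_eq_sqrt_re_inner ℂ, inner_sub_left, inner_sub_right, inner_sub_right]
    simp only [inner_expVector, RCLike.re_to_complex]
    congr 2
    ring
  simp_rw [h]
  have hc : Continuous fun u : Ell2 => Real.sqrt (Complex.exp (inner ℂ u u) -
      Complex.exp (inner ℂ u v) - Complex.exp (inner ℂ v u) + Complex.exp (inner ℂ v v)).re := by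
    fun_prop
  simpa using hc.tendsto v

/-- The Weyl cocycle depends on Im⟨sz, tz⟩, which vanishes for real multiples of one vector.
Totality of the exponential vectors reduces the identity to comparing exponents. -/
lemma weyl_add_smul (z : Ell2) (s t : ℝ) : weyl (((s + t : ℝ) : ℂ) • z) =
    weyl ((s : ℂ) • z) * weyl ((t : ℂ) • z) := by
  refine clm_ext_expVector fun u => ?_
  have e := inner_self_eq_norm_sq_to_K (𝕜 := ℂ) z
  simp only [Complex.coe_algebraMap] at e
  have hn : ∀ r : ℝ, ((‖(r : ℂ) • z‖ : ℝ) : ℂ) ^ 2 = (r : ℂ) ^ 2 * (‖z‖ : ℂ) ^ 2 := by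
    intro r
    rw [norm_smul, Complex.norm_real]
    norm_cast
    rw [mul_pow, Real.norm_eq_abs, sq_abs]
  rw [mul_apply_eq_comp, weyl_expVector, weyl_expVector, map_smul, weyl_expVector, smul_smul,
    ← Complex.exp_add, hn, hn, hn]
  congr 2
  · simp only [inner_smul_left, inner_add_right, inner_smul_right, Complex.conj_ofReal, e]
    push_cast
    ring
  · rw [Complex.ofReal_add, add_smul, add_assoc]

lemma isUnitaryGroup_weyl (z : Ell2) : IsUnitaryGroup fun t : ℝ => weyl ((t : ℂ) • z) where
  unitary_mem t := weyl_mem_unitary _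
  map_add := weyl_add_smul z
  continuous_apply := by
    refine continuous_apply_of_dense (fun t x => ?_) denseRange_expComb ?_
    · exact (ContinuousLinearMap.norm_map_iff_adjoint_comp_self _).mpr
        (Unitary.star_mul_self_of_mem (weyl_mem_unitary _)) x
    · rintro _ ⟨f, rfl⟩
      simp only [expComb, Finsupp.linearCombination_apply, Finsupp.sum, map_sum, map_smul,
        weyl_expVector]
      refine continuous_finsetSum _ fun u _ => ?_
      have h1 : Continuous fun t : ℝ =>
          Complex.exp (-(‖(t : ℂ) • z‖ : ℂ) ^ 2 / 2 - inner ℂ ((t : ℂ) • z) u) := by fun_prop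
      have h2 : Continuous fun t : ℝ => expVector ((t : ℂ) • z + u) :=
        continuous_expVector.comp (by fun_prop)
      exact (h1.smul h2).const_smul (f u)

/-! ### Moments of the centered fields in a Gaussian state -/

/-- The unitary group `e^{it(w,z)} W_{tz} = e^{-it(p(z)-(w,z))}`. -/
def centeredWeyl (w z : Ell2) (t : ℝ) : ModeSpace →L[ℂ] ModeSpace :=
  Complex.exp (Complex.I * t * realInner w z) • weyl ((t : ℂ) • z)

lemma isUnitaryGroup_centeredWeyl (w z : Ell2) : IsUnitaryGroup (centeredWeyl w z) :=
  (isUnitaryGroup_weyl z).cexp_smul _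

lemma generator_centeredWeyl (w z : Ell2) :
    generator (centeredWeyl w z) = centeredField w z :=
  generator_cexp_smul _ (isUnitaryGroup_weyl z).zero _

lemma realInner_ofReal_smul_right (w z : Ell2) (t : ℝ) :
    realInner w ((t : ℂ) • z) = t * realInner w z := by
  rw [realInner, inner_smul_right, Complex.re_ofReal_mul, realInner]

lemma realInner_ofReal_smul_left (w z : Ell2) (t : ℝ) :
    realInner ((t : ℂ) • w) z = t * realInner w z := by
  rw [realInner, inner_smul_left, Complex.conj_ofReal, Complex.re_ofReal_mul, realInner]

lemma IsGaussianState.trace_mul_centeredWeyl {ρ : ModeSpace →L[ℂ] ModeSpace} {w : Ell2}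
    {S : Ell2 →L[ℝ] Ell2} (hρ : IsGaussianState ρ w S) (z : Ell2) (t : ℝ) :
    trace (ρ * centeredWeyl w z t) = gaussFun (realInner z (S z)) t := by
  have hpi : (1 / (Real.sqrt Real.pi : ℂ)) ≠ 0 := by
    have : Real.sqrt Real.pi ≠ 0 := (Real.sqrt_pos.mpr Real.pi_pos).ne'
    exact one_div_ne_zero (by exact_mod_cast this)
  -- S is only real-linear; this suffices because t is real.
  have hS : S ((t : ℂ) • z) = (t : ℂ) • S z := by
    rw [Complex.coe_smul, map_smul, Complex.coe_smul]
    rfl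
  have h := mul_left_cancel₀ hpi (hρ.qFourier_eq ((t : ℂ) • z))
  rw [hS, realInner_ofReal_smul_right, realInner_ofReal_smul_right,
    realInner_ofReal_smul_left] at h
  rw [centeredWeyl, trace_mul_smul, h, ← Complex.exp_add, gaussFun]
  congr 1
  push_cast
  ring

/-- Positivity of S is not assumed: a state has norm at most one against a unitary, so e^{-σ/2} ≤ 1.
-/
lemma IsGaussianState.realInner_nonneg {ρ : ModeSpace →L[ℂ] ModeSpace} {w : Ell2}
    {S : Ell2 →L[ℝ] Ell2} (hρ : IsGaussianState ρ w S) (z : Ell2) : 0 ≤ realInner z (S z) := by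
  have h := (hρ.isState.norm_trace_mul_le (centeredWeyl w z 1)).trans
    ((isUnitaryGroup_centeredWeyl w z).norm_le_one 1)
  rw [hρ.trace_mul_centeredWeyl, gaussFun, ← Complex.ofReal_neg, Complex.norm_exp_ofReal,
    Real.exp_le_one_iff] at h
  linarith

lemma IsGaussianState.hasMoment {ρ : ModeSpace →L[ℂ] ModeSpace} {w : Ell2}
    {S : Ell2 →L[ℝ] Ell2} (hρ : IsGaussianState ρ w S) (z : Ell2) (n : ℕ) :
    HasMoment ρ (centeredField w z) n
      ((-Complex.I) ^ n * ((-1) ^ n * iteratedDeriv n (gaussFun (realInner z (S z))) 0)) := by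
  choose C hC using bounded_iteratedDeriv_gaussFun (hρ.realInner_nonneg z)
  let F : ℕ → ℝ →ᵇ ℂ := fun n => BoundedContinuousFunction.ofNormedAddCommGroup
    (iteratedDeriv n (gaussFun (realInner z (S z))))
    ((contDiff_gaussFun _ (n := n)).continuous_iteratedDeriv' n) (C n) (hC n)
  rw [← generator_centeredWeyl]
  refine (isUnitaryGroup_centeredWeyl w z).hasMoment hρ.isState (F := F)
    (fun n t => hasDerivAt_iteratedDeriv_gaussFun _ n t) (fun t => ?_) n
  rw [hρ.trace_mul_centeredWeyl]
  simp [F]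

/-- Here e^{itA} is V(-t). The Gaussian is even, so reversing time leaves the trace function
unchanged; the value differs from that in `IsGaussianState.hasMoment` by (-1)^n, harmless since odd
derivatives vanish at 0. -/
lemma IsGaussianState.hasDerivMoment {ρ : ModeSpace →L[ℂ] ModeSpace} {w : Ell2}
    {S : Ell2 →L[ℝ] Ell2} (hρ : IsGaussianState ρ w S) (z : Ell2) (n : ℕ) :
    HasDerivMoment ρ (centeredField w z) n
      ((-Complex.I) ^ n * iteratedDeriv n (gaussFun (realInner z (S z))) 0) := by
  have h : (fun t => trace (ρ * centeredWeyl w z (-t))) = gaussFun (realInner z (S z)) := by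
    funext t
    rw [hρ.trace_mul_centeredWeyl]
    simp [gaussFun]
  refine ⟨fun t => centeredWeyl w z (-t), ⟨(isUnitaryGroup_centeredWeyl w z).comp_neg, ?_⟩, ?_, ?_⟩
  · simp only [neg_neg]
    exact generator_centeredWeyl w z
  · rw [h]
    exact (contDiff_gaussFun _).contDiffAt
  · rw [h]

end

end BosonGaussian

theorem mainTheorem7 (ρ : BosonGaussian.ModeSpace →L[ℂ] BosonGaussian.ModeSpace)
    (w : BosonGaussian.Ell2) (S : BosonGaussian.Ell2 →L[ℝ] BosonGaussian.Ell2)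
    (hρ : BosonGaussian.IsGaussianState ρ w S) (z : BosonGaussian.Ell2) (n : ℕ) :
    (Odd n →
      BosonGaussian.HasMoment ρ (BosonGaussian.centeredField w z) n 0 ∧
      BosonGaussian.HasDerivMoment ρ (BosonGaussian.centeredField w z) n 0) ∧
    (Even n →
      BosonGaussian.HasMoment ρ (BosonGaussian.centeredField w z) n
        ((BosonGaussian.realInner z (S z) ^ (n / 2) * (Nat.doubleFactorial (n - 1) : ℝ) : ℝ) : ℂ) ∧
      BosonGaussian.HasDerivMoment ρ (BosonGaussian.centeredField w z) n
        ((BosonGaussian.realInner z (S z) ^ (n / 2) * (Nat.doubleFactorial (n - 1) : ℝ) : ℝ) : ℂ)) := by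
  have h1 := hρ.hasMoment z n
  have h2 := hρ.hasDerivMoment z n
  refine ⟨?_, ?_⟩
  · rintro ⟨k, rfl⟩
    rw [(BosonGaussian.iteratedDeriv_gaussFun_zero _ k).1, mul_zero] at h1 h2
    rw [mul_zero] at h1
    exact ⟨h1, h2⟩
  · intro hn
    obtain ⟨k, rfl⟩ := hn.two_dvd
    rw [(BosonGaussian.iteratedDeriv_gaussFun_zero _ k).2] at h1 h2
    -- The factor (-i)^{2k} cancels the alternating sign of the even derivatives of the Gaussian.
    have hI : (-Complex.I) ^ (2 * k) * (-1) ^ k = 1 := by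
      rw [pow_mul, neg_sq, Complex.I_sq, ← mul_pow]
      simp
    rw [hn.neg_one_pow, one_mul, ← mul_assoc, hI, one_mul] at h1
    rw [← mul_assoc, hI, one_mul] at h2
    rw [Nat.mul_div_cancel_left k two_pos]
    exact ⟨h1, h2⟩
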